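/- Let $\mathcal D$ be a unital $C^*$-algebra. For $n\in\mathbb N$ let $\mathcal D^n=\mathcal D^{\otimes_{\max} n}$ be the completion of the algebraic tensor product of $n$ copies of $\mathcal D$ in the maximal $C^*$-norm $\|x\|_{\max}=\sup\{\|\pi(x)\| : \pi \text{ a } {*}\text{-representation of the algebraic tensor product on a Hilbert space}\}$. Let $\mathcal D^\infty=\lim_{n}\mathcal D^n$ be the $C^*$-algebraic inductive limit along the maps $\mathcal D^n\to\mathcal D^{n+k}$, $x\mapsto x\otimes 1^{\otimes k}$, i.e. the completion of the union of the $\mathcal D^n$ in the norm $\lim_{k}\|x\otimes 1^{\otimes k}\|_{\mathcal D^{n+k}}$. A permutation $\pi\in S_n$ acts on $\mathcal D^n$ by $\alpha_\pi(x_1\otimes\dots\otimes x_n)=x_{\pi(1)}\otimes\dots\otimes x_{\pi(n)}$, on $\mathcal D^{n+k}$ by permuting the first $n$ factors, and by continuity on $\mathcal D^\infty$. A state (normalized positive linear functional) $\rho$ on $\mathcal D^\infty$ is symmetric if $\rho(\alpha_\pi(x))=\rho(x)$ for all $n$, all $\pi\in S_n$ and all $x\in\mathcal D^\infty$. Let $K(\mathcal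 D)$ be the set of states of $\mathcal D$ with the weak-$*$ topology and its Borel $\sigma$-algebra, and for $\sigma\in K(\mathcal D)$ let $\Pi_\sigma$ be the infinite product state on $\mathcal D^\infty$, determined by $\Pi_\sigma(x_1\otimes\dots\otimes x_n)=\sigma(x_1)\cdots\sigma(x_n)$ for all $n$ and all $x_1,\dots,x_n\in\mathcal D$. **Theorem (Quantum de Finetti Theorem for the maximal tensor product).** Let $\rho$ be a symmetric state on $\mathcal D^\infty$. Then there exists a unique regular Borel probability measure $\mu$ on $K(\mathcal D)$ such that for all $x\in\mathcal D^\infty$ the function $\sigma\mapsto\Pi_\sigma(x)$ is $\mu$-integrable and $$\rho(x)=\int_{K(\mathcal D)}\Pi_\sigma(x)\,\mathrm d\mu(\sigma).$$ -/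

import Mathlib

noncomputable section

namespace QuantumDeFinetti

open Topology MeasureTheory Filter
open scoped TensorProduct ComplexOrder CStarAlgebra

set_option linter.unusedSectionVars false

universe u v

/-! ### Completion of a `*`-algebra in a C*-seminorm -/

/-- A C*-seminorm on a unital complex `*`-algebra. -/
structure CStarSeminorm (A : Type u) [Ring A] [StarRing A] [Algebra ℂ A] extends
    Seminorm ℂ A where
  mul_le' : ∀ x y, toFun (x * y) ≤ toFun x * toFun y
  star_mul_self' : ∀ x, toFun (star x * x) = toFun x * toFun x

namespace CStarSeminorm

variable {A : Type u} [Ring A] [StarRing A] [Algebra ℂ A] [StarModule ℂ A]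

/-- The algebra `A`, regarded as a seminormed algebra with the seminorm `p`. -/
def Pre (_p : CStarSeminorm A) : Type u := A

variable (p : CStarSeminorm A)

instance : Ring p.Pre := inferInstanceAs (Ring A)
instance : StarRing p.Pre := inferInstanceAs (StarRing A)
instance : Algebra ℂ p.Pre := inferInstanceAs (Algebra ℂ A)
instance : StarModule ℂ p.Pre := inferInstanceAs (StarModule ℂ A)

/-- The identity map from `A` to `p.Pre`. -/
def toPre : A →⋆ₐ[ℂ] p.Pre := StarAlgHom.id ℂ A

instance : SeminormedRing p.Pre where
  __ := (inferInstance : Ring p.Pre)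
  __ := p.toSeminorm.toAddGroupSeminorm.toSeminormedAddCommGroup
  norm_mul_le := p.mul_le'

theorem norm_toPre (x : A) : ‖p.toPre x‖ = p.toSeminorm x := rfl

instance : NormedAlgebra ℂ p.Pre where
  norm_smul_le c x := (map_smul_eq_mul p.toSeminorm c x).le

theorem norm_star_mul_self_pre (x : p.Pre) : ‖star x * x‖ = ‖x‖ * ‖x‖ := p.star_mul_self' x

theorem norm_star_le_pre (x : p.Pre) : ‖x‖ ≤ ‖star x‖ := by
  rcases (norm_nonneg x).eq_or_lt with h | h
  · rw [← h]; exact norm_nonneg _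
  · have h1 := norm_mul_le (star x) x
    rw [norm_star_mul_self_pre] at h1
    exact le_of_mul_le_mul_right h1 h

instance : NormedStarGroup p.Pre where
  norm_star_le x := by simpa using norm_star_le_pre p (star x)

/-- The underlying type of the completion of `A` in `p`. -/
abbrev PreCompletion : Type u := UniformSpace.Completion p.Pre

instance : NormedAlgebra ℂ p.PreCompletion where
  norm_smul_le := norm_smul_le

/-- The underlying map from the seminormed algebra to its completion. -/
def coe (x : p.Pre) : p.PreCompletion := UniformSpace.Completion.coe' x

@[elab_as_elim]
theorem completion_ind {P : p.PreCompletion → Prop} (x : p.PreCompletion)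
    (hc : IsClosed {x | P x}) (h : ∀ a, P (p.coe a)) : P x :=
  UniformSpace.Completion.induction_on x hc h

theorem continuous_coe : Continuous p.coe := UniformSpace.Completion.continuous_coe p.Pre

instance : Star p.PreCompletion where
  star x := UniformSpace.Completion.map (star : p.Pre → p.Pre) x

theorem continuous_star_completion : Continuous (star : p.PreCompletion → p.PreCompletion) :=
  UniformSpace.Completion.continuous_map

theorem coe_star (x : p.Pre) : p.coe (star x) = star (p.coe x) :=
  (UniformSpace.Completion.map_coe (star_isometry (E := p.Pre)).uniformContinuous x).symm

theorem coe_mul (x y : p.Pre) : p.coe (x * y) = p.coe x * p.coe y :=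
  UniformSpace.Completion.coe_mul x y
theorem coe_add (x y : p.Pre) : p.coe (x + y) = p.coe x + p.coe y :=
  UniformSpace.Completion.coe_add x y
theorem coe_smul (c : ℂ) (x : p.Pre) : p.coe (c • x) = c • p.coe x :=
  UniformSpace.Completion.coe_smul c x
theorem norm_coe (x : p.Pre) : ‖p.coe x‖ = ‖x‖ :=
  UniformSpace.Completion.norm_coe x

instance : StarRing p.PreCompletion where
  star_involutive x := by
    induction x using completion_ind with
    | hc => exact isClosed_eq
              (p.continuous_star_completion.comp p.continuous_star_completion) continuous_id
    | h a => rw [← coe_star, ← coe_star, star_star]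
  star_mul x y := by
    induction x using completion_ind with
    | hc =>
      exact isClosed_eq (p.continuous_star_completion.comp (continuous_id.mul continuous_const))
        (continuous_const.mul p.continuous_star_completion)
    | h a =>
      induction y using completion_ind with
      | hc =>
        exact isClosed_eq (p.continuous_star_completion.comp (continuous_const.mul continuous_id))
          (p.continuous_star_completion.mul continuous_const)
      | h b => rw [← coe_mul, ← coe_star, ← coe_star, ← coe_star, star_mul, coe_mul]
  star_add x y := by
    induction x using completion_ind with
    | hc =>
      exact isClosed_eq (p.continuous_star_completion.comp (continuous_id.add continuous_const))
        (p.continuous_star_completion.add continuous_const)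
    | h a =>
      induction y using completion_ind with
      | hc =>
        exact isClosed_eq (p.continuous_star_completion.comp (continuous_const.add continuous_id))
          (continuous_const.add p.continuous_star_completion)
      | h b => rw [← coe_add, ← coe_star, ← coe_star, ← coe_star, star_add, coe_add]

instance : StarModule ℂ p.PreCompletion where
  star_smul c x := by
    induction x using completion_ind with
    | hc =>
      exact isClosed_eq (p.continuous_star_completion.comp (continuous_id.const_smul c))
        (p.continuous_star_completion.const_smul (star c))
    | h a => rw [← coe_smul, ← coe_star, ← coe_star, star_smul, coe_smul]

instance : CStarRing p.PreCompletion where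
  norm_mul_self_le x := by
    induction x using completion_ind with
    | hc =>
      exact isClosed_le (continuous_norm.mul continuous_norm)
        (continuous_norm.comp (p.continuous_star_completion.mul continuous_id))
    | h a => rw [← coe_star, ← coe_mul, norm_coe, norm_coe, norm_star_mul_self_pre]

instance : CStarAlgebra p.PreCompletion where

/-- The C*-algebra obtained by completing `A` in the C*-seminorm `p` (elements of seminorm zero
become zero). -/
def Completion : Type u := p.PreCompletion

instance : CStarAlgebra p.Completion := inferInstanceAs (CStarAlgebra p.PreCompletion)

/-- The canonical `*`-homomorphism from `A` to its completion. -/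
def toCompletion : A →⋆ₐ[ℂ] p.Completion where
  toFun x := p.coe (p.toPre x)
  map_one' := UniformSpace.Completion.coe_one p.Pre
  map_mul' _ _ := p.coe_mul _ _
  map_zero' := UniformSpace.Completion.coe_zero (α := p.Pre)
  map_add' _ _ := p.coe_add _ _
  commutes' _ := rfl
  map_star' _ := p.coe_star _

theorem norm_toCompletion (x : A) : ‖p.toCompletion x‖ = p.toSeminorm x := p.norm_coe _

theorem denseRange_toCompletion : DenseRange p.toCompletion :=
  UniformSpace.Completion.denseRange_coe (α := p.Pre)

variable {p} in
/-- A linear map that is bounded in the seminorm `p` extends to the completion. -/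
def liftCLM {F : Type v} [NormedAddCommGroup F] [NormedSpace ℂ F] [CompleteSpace F]
    (f : A →ₗ[ℂ] F) (hf : ∀ x, ‖f x‖ ≤ p.toSeminorm x) : p.Completion →L[ℂ] F :=
  ((LinearMap.mkContinuous (E := p.Pre) f 1 (fun x => (hf x).trans_eq (one_mul _).symm)).extend
    (UniformSpace.Completion.toComplL (𝕜 := ℂ) (E := p.Pre)))

theorem liftCLM_toCompletion {F : Type v} [NormedAddCommGroup F] [NormedSpace ℂ F]
    [CompleteSpace F] (f : A →ₗ[ℂ] F) (hf : ∀ x, ‖f x‖ ≤ p.toSeminorm x) (x : A) :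
    liftCLM f hf (p.toCompletion x) = f x :=
  ContinuousLinearMap.extend_eq
    (e := (UniformSpace.Completion.toComplL (𝕜 := ℂ) (E := p.Pre))) _ (UniformSpace.Completion.denseRange_coe (α := p.Pre))
    (UniformSpace.Completion.isUniformInducing_coe p.Pre) x

/-- A `*`-homomorphism to a C*-algebra that is contractive for the seminorm `p` extends to
the completion. -/
def lift {B : Type v} [CStarAlgebra B] (f : A →⋆ₐ[ℂ] B)
    (hf : ∀ x, ‖f x‖ ≤ p.toSeminorm x) : p.Completion →⋆ₐ[ℂ] B :=
  let g := liftCLM (p := p) f.toAlgHom.toLinearMap hf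
  have hg : ∀ x, g (p.toCompletion x) = f x := liftCLM_toCompletion p f.toAlgHom.toLinearMap hf
  have hmul : ∀ x y, g (x * y) = g x * g y := fun x y => by
    induction x using p.denseRange_toCompletion.induction_on with
    | hp => exact isClosed_eq (by fun_prop) (by fun_prop)
    | ih a =>
      induction y using p.denseRange_toCompletion.induction_on with
      | hp => exact isClosed_eq (by fun_prop) (by fun_prop)
      | ih b => rw [← map_mul, hg, hg, hg, map_mul]
  have hone : g 1 = 1 := by rw [← map_one p.toCompletion, hg, map_one]
  { AlgHom.ofLinearMap g.toLinearMap hone hmul with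
    map_star' := fun x => by
      change g (star x) = star (g x)
      induction x using p.denseRange_toCompletion.induction_on with
      | hp => exact isClosed_eq (by fun_prop) (by fun_prop)
      | ih a => rw [← map_star, hg, hg, map_star] }

@[simp]
theorem lift_toCompletion {B : Type v} [CStarAlgebra B] (f : A →⋆ₐ[ℂ] B)
    (hf : ∀ x, ‖f x‖ ≤ p.toSeminorm x) (x : A) : p.lift f hf (p.toCompletion x) = f x :=
  liftCLM_toCompletion p f.toAlgHom.toLinearMap hf x

end CStarSeminorm

/-! ### The universal C*-seminorm of a `*`-algebra -/

section Universal

variable {A : Type u} [Ring A] [StarRing A] [Algebra ℂ A] [StarModule ℂ A]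

/-- The norms `‖π x‖`, where `π` runs over all `*`-representations of `A` by bounded operators on
a Hilbert space. -/
def repNorms (x : A) : Set ℝ :=
  {r | ∃ (H : Type u) (_ : NormedAddCommGroup H) (_ : InnerProductSpace ℂ H)
    (_ : CompleteSpace H) (π : A →⋆ₐ[ℂ] (H →L[ℂ] H)), r = ‖π x‖}

theorem repNorms_nonempty (x : A) : (repNorms x).Nonempty := by
  let e : A →⋆ₐ[ℂ] (PUnit.{u + 1} →L[ℂ] PUnit.{u + 1}) :=
    { toFun := fun _ => 0
      map_one' := Subsingleton.elim _ _
      map_mul' := fun _ _ => Subsingleton.elim _ _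
      map_zero' := rfl
      map_add' := fun _ _ => Subsingleton.elim _ _
      commutes' := fun _ => Subsingleton.elim _ _
      map_star' := fun _ => Subsingleton.elim _ _ }
  exact ⟨_, PUnit, inferInstance, inferInstance, inferInstance, e, rfl⟩

theorem repNorms_nonneg (x : A) : ∀ r ∈ repNorms x, 0 ≤ r := by
  rintro r ⟨H, _, _, _, π, rfl⟩
  exact norm_nonneg _

/-- The supremum of `‖π x‖` over all representations `π`, as a C*-seminorm, for a `*`-algebra
in which all these suprema are finite. -/
def universalSeminorm (h : ∀ x : A, BddAbove (repNorms x)) : CStarSeminorm A where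
  toSeminorm := Seminorm.ofSMulLE (fun x => sSup (repNorms x))
    (by
      refine le_antisymm (csSup_le (repNorms_nonempty _) ?_) (Real.sSup_nonneg (repNorms_nonneg _))
      rintro r ⟨H, _, _, _, π, rfl⟩
      simp)
    (fun x y => by
      refine csSup_le (repNorms_nonempty _) ?_
      rintro r ⟨H, _, _, _, π, rfl⟩
      rw [map_add]
      exact (norm_add_le _ _).trans (add_le_add
        (le_csSup (h x) ⟨H, _, _, ‹_›, π, rfl⟩) (le_csSup (h y) ⟨H, _, _, ‹_›, π, rfl⟩)))
    (fun c x => by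
      refine csSup_le (repNorms_nonempty _) ?_
      rintro r ⟨H, _, _, _, π, rfl⟩
      rw [map_smul, norm_smul]
      exact mul_le_mul_of_nonneg_left (le_csSup (h x) ⟨H, _, _, ‹_›, π, rfl⟩) (norm_nonneg c))
  mul_le' x y := by
    refine csSup_le (repNorms_nonempty _) ?_
    rintro r ⟨H, _, _, _, π, rfl⟩
    rw [map_mul]
    exact (norm_mul_le _ _).trans (mul_le_mul
      (le_csSup (h x) ⟨H, _, _, ‹_›, π, rfl⟩) (le_csSup (h y) ⟨H, _, _, ‹_›, π, rfl⟩)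
      (norm_nonneg _) (Real.sSup_nonneg (repNorms_nonneg _)))
  star_mul_self' x := by
    change sSup (repNorms (star x * x)) = sSup (repNorms x) * sSup (repNorms x)
    have h0 : 0 ≤ sSup (repNorms x) := Real.sSup_nonneg (repNorms_nonneg _)
    refine le_antisymm (csSup_le (repNorms_nonempty _) ?_) ?_
    · rintro r ⟨H, _, _, _, π, rfl⟩
      rw [map_mul, map_star, CStarRing.norm_star_mul_self]
      have := le_csSup (h x) ⟨H, _, _, ‹_›, π, rfl⟩
      exact mul_le_mul this this (norm_nonneg _) h0
    · have h1 : 0 ≤ sSup (repNorms (star x * x)) := Real.sSup_nonneg (repNorms_nonneg _)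
      have h2 : sSup (repNorms x) ≤ √(sSup (repNorms (star x * x))) := by
        refine csSup_le (repNorms_nonempty _) ?_
        rintro r ⟨H, _, _, _, π, rfl⟩
        refine Real.le_sqrt_of_sq_le ?_
        rw [sq, ← CStarRing.norm_star_mul_self, ← map_star, ← map_mul]
        exact le_csSup (h _) ⟨H, _, _, ‹_›, π, rfl⟩
      calc _ ≤ √(sSup (repNorms (star x * x))) * √(sSup (repNorms (star x * x))) :=
            mul_le_mul h2 h2 h0 (Real.sqrt_nonneg _)
        _ = _ := Real.mul_self_sqrt h1

theorem universalSeminorm_apply (h : ∀ x : A, BddAbove (repNorms x)) (x : A) :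
    (universalSeminorm h).toSeminorm x = sSup (repNorms x) := rfl

theorem le_universalSeminorm (h : ∀ x : A, BddAbove (repNorms x)) {H : Type u}
    [NormedAddCommGroup H] [InnerProductSpace ℂ H] [CompleteSpace H]
    (π : A →⋆ₐ[ℂ] (H →L[ℂ] H)) (x : A) : ‖π x‖ ≤ (universalSeminorm h).toSeminorm x :=
  le_csSup (h x) ⟨H, _, _, ‹_›, π, rfl⟩

end Universal

/-! ### Inductive limits of sequences of C*-algebras -/

namespace CStarIndLim

variable {A : ℕ → Type u} [∀ n, CStarAlgebra (A n)] (f : ∀ i j, i ≤ j → (A i →⋆ₐ[ℂ] A j))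
  [DirectedSystem A (f · · ·)]

/-- The limit norm `lim_k ‖f_{i,i+k} x‖` of an element `x` of the `i`-th algebra. The sequence is
non-increasing, so that the limit is the infimum (see `tendsto_limNorm`). -/
def limNorm (i : ℕ) (x : A i) : ℝ := ⨅ k : ℕ, ‖f i (i + k) (Nat.le_add_right i k) x‖

theorem norm_f_congr {i m n : ℕ} (hm : i ≤ m) (h : m = n) (x : A i) :
    ‖f i m hm x‖ = ‖f i n (h ▸ hm) x‖ := by subst h; rfl

theorem antitone_norm (i : ℕ) (x : A i) :
    Antitone fun k : ℕ => ‖f i (i + k) (Nat.le_add_right i k) x‖ := by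
  refine antitone_nat_of_succ_le fun k => ?_
  change ‖f i (i + k + 1) _ x‖ ≤ _
  rw [← DirectedSystem.map_map' f (Nat.le_add_right i k) (Nat.le_succ (i + k)) x]
  exact NonUnitalStarAlgHom.norm_apply_le (f (i + k) (i + k + 1) (Nat.le_succ _)) _

theorem tendsto_limNorm (i : ℕ) (x : A i) :
    Tendsto (fun k : ℕ => ‖f i (i + k) (Nat.le_add_right i k) x‖) atTop (𝓝 (limNorm f i x)) :=
  tendsto_atTop_ciInf (antitone_norm f i x) ⟨0, by rintro _ ⟨k, rfl⟩; exact norm_nonneg _⟩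

theorem limNorm_compat (i j : ℕ) (h : i ≤ j) (x : A i) :
    limNorm f i x = limNorm f j (f i j h x) := by
  obtain ⟨d, rfl⟩ := Nat.exists_eq_add_of_le h
  refine tendsto_nhds_unique (((tendsto_limNorm f i x).comp (tendsto_add_atTop_nat d)).congr ?_)
    (tendsto_limNorm f (i + d) _)
  intro k
  rw [DirectedSystem.map_map' f]
  exact norm_f_congr f _ (by change i + (k + d) = i + d + k; omega) x

/-- The limit norm on the algebraic inductive limit (the local algebra). -/
def localNorm : DirectLimit A f → ℝ := DirectLimit.lift f (limNorm f) (limNorm_compat f)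

theorem localNorm_mk (i : ℕ) (x : A i) : localNorm f ⟦⟨i, x⟩⟧ = limNorm f i x := rfl

/-- The limit norm as a C*-seminorm on the algebraic inductive limit (the local algebra). -/
def limSeminorm : CStarSeminorm (DirectLimit A f) where
  toSeminorm := Seminorm.ofSMulLE (localNorm f)
    (by
      rw [DirectLimit.zero_def 0, localNorm_mk]
      exact tendsto_nhds_unique (tendsto_limNorm f 0 0) (by simp))
    (DirectLimit.induction₂ f fun i x y => by
      rw [DirectLimit.add_def]
      simp only [localNorm_mk]
      refine le_of_tendsto_of_tendsto' (tendsto_limNorm f i _)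
        ((tendsto_limNorm f i x).add (tendsto_limNorm f i y)) fun k => ?_
      rw [map_add]
      exact norm_add_le _ _)
    (fun c => DirectLimit.induction f fun i x => by
      rw [DirectLimit.smul_def]
      simp only [localNorm_mk]
      refine le_of_tendsto_of_tendsto' (tendsto_limNorm f i _)
        ((tendsto_limNorm f i x).const_mul ‖c‖) fun k => ?_
      rw [map_smul, norm_smul])
  mul_le' := DirectLimit.induction₂ f fun i x y => by
    change localNorm f (⟦⟨i, x⟩⟧ * ⟦⟨i, y⟩⟧) ≤ localNorm f ⟦⟨i, x⟩⟧ * localNorm f ⟦⟨i, y⟩⟧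
    rw [DirectLimit.mul_def]
    simp only [localNorm_mk]
    refine le_of_tendsto_of_tendsto' (tendsto_limNorm f i _)
      ((tendsto_limNorm f i x).mul (tendsto_limNorm f i y)) fun k => ?_
    rw [map_mul]
    exact norm_mul_le _ _
  star_mul_self' := DirectLimit.induction f fun i x => by
    change localNorm f (star (⟦⟨i, x⟩⟧ : DirectLimit A f) * ⟦⟨i, x⟩⟧) = localNorm f ⟦⟨i, x⟩⟧ * localNorm f ⟦⟨i, x⟩⟧
    rw [DirectLimit.star_def, DirectLimit.mul_def]
    simp only [localNorm_mk]
    refine tendsto_nhds_unique (tendsto_limNorm f i _)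
      (((tendsto_limNorm f i x).mul (tendsto_limNorm f i x)).congr fun k => ?_)
    rw [map_mul, map_star, CStarRing.norm_star_mul_self]

/-- The C*-algebraic inductive limit: the completion of the local algebra in the limit norm. -/
abbrev Limit : Type u := (limSeminorm f).Completion

/-- The canonical map of the `i`-th algebra into the algebraic inductive limit. -/
def ofLocal (i : ℕ) : A i →⋆ₐ[ℂ] DirectLimit A f where
  toFun x := ⟦⟨i, x⟩⟧
  map_one' := (DirectLimit.one_def i).symm
  map_mul' _ _ := (DirectLimit.mul_def ..).symm
  map_zero' := (DirectLimit.zero_def i).symm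
  map_add' _ _ := (DirectLimit.add_def ..).symm
  commutes' r := (DirectLimit.algebraMap_def i r).symm
  map_star' _ := (DirectLimit.star_def ..).symm

/-- The canonical map of the `i`-th algebra into the inductive limit. -/
def of (i : ℕ) : A i →⋆ₐ[ℂ] Limit f := (limSeminorm f).toCompletion.comp (ofLocal f i)

theorem of_f (i j : ℕ) (h : i ≤ j) (x : A i) : of f j (f i j h x) = of f i x :=
  congrArg (limSeminorm f).toCompletion (DirectLimit.eq_of_le (f := f) ⟨i, x⟩ j h).symm

theorem of_ind {P : Limit f → Prop} (x : Limit f) (hc : IsClosed {x | P x})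
    (h : ∀ i (a : A i), P (of f i a)) : P x := by
  induction x using (limSeminorm f).denseRange_toCompletion.induction_on with
  | hp => exact hc
  | ih a => exact DirectLimit.induction f (fun i a => h i a) a

/-- A linear functional on the local algebra from a compatible family. -/
def liftLocalLinear {F : Type v} [AddCommGroup F] [Module ℂ F] (g : ∀ i, A i →ₗ[ℂ] F)
    (hg : ∀ i j h x, g i x = g j (f i j h x)) : DirectLimit A f →ₗ[ℂ] F where
  toFun := DirectLimit.lift f (fun i x => g i x) hg
  map_add' := DirectLimit.induction₂ f fun i x y => by
    rw [DirectLimit.add_def]; simp only [DirectLimit.lift_def, map_add]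
  map_smul' c := DirectLimit.induction f fun i x => by
    rw [DirectLimit.smul_def]; simp only [DirectLimit.lift_def, map_smul, RingHom.id_apply]

/-- A compatible family of `*`-homomorphisms to a C*-algebra, as a map on the local algebra. -/
def liftLocal {B : Type v} [CStarAlgebra B] (g : ∀ i, A i →⋆ₐ[ℂ] B)
    (hg : ∀ i j h x, g i x = g j (f i j h x)) : DirectLimit A f →⋆ₐ[ℂ] B where
  toFun := DirectLimit.lift f (fun i x => g i x) hg
  map_one' := by rw [DirectLimit.one_def 0]; simp only [DirectLimit.lift_def, map_one]
  map_mul' := DirectLimit.induction₂ f fun i x y => by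
    rw [DirectLimit.mul_def]; simp only [DirectLimit.lift_def, map_mul]
  map_zero' := by rw [DirectLimit.zero_def 0]; simp only [DirectLimit.lift_def, map_zero]
  map_add' := DirectLimit.induction₂ f fun i x y => by
    rw [DirectLimit.add_def]; simp only [DirectLimit.lift_def, map_add]
  commutes' r := by
    rw [DirectLimit.algebraMap_def 0]; simp only [DirectLimit.lift_def]; exact (g 0).commutes' r
  map_star' := DirectLimit.induction f fun i x => by
    rw [DirectLimit.star_def]; simp only [DirectLimit.lift_def, map_star]

/-- The extension of a compatible family of `*`-homomorphisms to the inductive limit. -/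
def lift {B : Type v} [CStarAlgebra B] (g : ∀ i, A i →⋆ₐ[ℂ] B)
    (hg : ∀ i j h x, g i x = g j (f i j h x)) : Limit f →⋆ₐ[ℂ] B :=
  (limSeminorm f).lift (liftLocal f g hg) (DirectLimit.induction f fun i x => by
    change ‖g i x‖ ≤ limNorm f i x
    refine ge_of_tendsto' (tendsto_limNorm f i x) fun k => ?_
    rw [hg i (i + k) (Nat.le_add_right i k) x]
    exact NonUnitalStarAlgHom.norm_apply_le (g (i + k)) _)

@[simp]
theorem lift_of {B : Type v} [CStarAlgebra B] (g : ∀ i, A i →⋆ₐ[ℂ] B)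
    (hg : ∀ i j h x, g i x = g j (f i j h x)) (i : ℕ) (x : A i) :
    lift f g hg (of f i x) = g i x :=
  CStarSeminorm.lift_toCompletion _ _ _ _

end CStarIndLim

/-! ### Maximal tensor powers -/

section AlgTensor

variable {D : Type u} [CStarAlgebra D]

/-- The algebraic tensor product of `n` copies of `D`, with the factorwise product. -/
abbrev AlgTensorPower (D : Type u) [CStarAlgebra D] (n : ℕ) : Type u := ⨂[ℂ] _ : Fin n, D

open Function
open PiTensorProduct hiding tprod

/-- The factorwise involution `x₁ ⊗ ⋯ ⊗ xₙ ↦ x₁* ⊗ ⋯ ⊗ xₙ*`, extended antilinearly. -/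
def algTensorStar (n : ℕ) : AlgTensorPower D n →+ AlgTensorPower D n :=
  liftAddHom (fun q : ℂ × (Fin n → D) => star q.1 • PiTensorProduct.tprod ℂ (star q.2))
    (fun r x i hx => by
      change star r • PiTensorProduct.tprod ℂ (star x) = 0
      rw [(PiTensorProduct.tprod ℂ).map_coord_zero (m := star x) i (by simp [hx]), smul_zero])
    (fun x => by simp)
    (fun r x i a b => by
      have h : ∀ c : D, star (update x i c) = update (star x) i (star c) := fun c => by
        ext j; by_cases hj : j = i
        · subst hj; simp
        · simp [hj]
      simp only [h, star_add, MultilinearMap.map_update_add, smul_add])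
    (fun r s x => by simp [add_smul])
    (fun r x i s => by
      have h : star (update x i (s • x i)) = update (star x) i (star s • (star x) i) := by
        ext j; by_cases hj : j = i
        · subst hj; simp
        · simp [hj]
      simp only [h, MultilinearMap.map_update_smul, update_eq_self, star_mul', smul_smul]
      rw [mul_comm])

instance (n : ℕ) : Star (AlgTensorPower D n) := ⟨algTensorStar n⟩

theorem star_smul_tprod {n : ℕ} (r : ℂ) (x : Fin n → D) :
    star (r • PiTensorProduct.tprod ℂ x : AlgTensorPower D n) = star r • PiTensorProduct.tprod ℂ (star x) := by
  rw [← tprodCoeff_eq_smul_tprod]; rfl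

theorem algStar_add {n : ℕ} (x y : AlgTensorPower D n) : star (x + y) = star x + star y :=
  map_add (algTensorStar n) x y

instance (n : ℕ) : StarRing (AlgTensorPower D n) where
  star_add := algStar_add
  star_involutive x := by
    induction x using PiTensorProduct.induction_on with
    | smul_tprod r x => rw [star_smul_tprod, star_smul_tprod, star_star, star_star]
    | add x y hx hy => rw [algStar_add, algStar_add, hx, hy]
  star_mul x y := by
    induction x using PiTensorProduct.induction_on with
    | smul_tprod r x =>
      induction y using PiTensorProduct.induction_on with
      | smul_tprod s y =>
        rw [smul_tprod_mul_smul_tprod, star_smul_tprod, star_smul_tprod, star_smul_tprod,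
          smul_tprod_mul_smul_tprod, star_mul, star_mul]
      | add y z hy hz => rw [mul_add, algStar_add, algStar_add, hy, hz, add_mul]
    | add x z hx hz => rw [add_mul, algStar_add, algStar_add, hx, hz, mul_add]

instance (n : ℕ) : StarModule ℂ (AlgTensorPower D n) where
  star_smul c x := by
    induction x using PiTensorProduct.induction_on with
    | smul_tprod r x => rw [smul_smul, star_smul_tprod, star_smul_tprod, smul_smul, star_mul']
    | add x y hx hy => rw [smul_add, algStar_add, algStar_add, hx, hy, smul_add]

theorem star_tprod {n : ℕ} (x : Fin n → D) :
    star (PiTensorProduct.tprod ℂ x : AlgTensorPower D n) = PiTensorProduct.tprod ℂ (star x) := by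
  simpa using star_smul_tprod 1 x

/-- The embedding of `D` as the `i`-th tensor factor. -/
def siteHom {n : ℕ} (i : Fin n) : D →⋆ₐ[ℂ] AlgTensorPower D n where
  __ := singleAlgHom (R := ℂ) (A := fun _ : Fin n => D) i
  map_star' x := by
    change PiTensorProduct.tprod ℂ (Pi.mulSingle (M := fun _ => D) i (star x)) =
      star (PiTensorProduct.tprod ℂ (Pi.mulSingle (M := fun _ => D) i x))
    rw [star_tprod]
    congr 1
    ext j; by_cases hj : j = i
    · subst hj; simp
    · simp [hj]

theorem siteHom_apply {n : ℕ} (i : Fin n) (d : D) :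
    siteHom i d = PiTensorProduct.tprod ℂ (Pi.mulSingle (M := fun _ => D) i d) := rfl

/-- Elements of the algebraic tensor power are generated by the single-site ones. -/
theorem algTensor_ind {n : ℕ} {P : AlgTensorPower D n → Prop} (x : AlgTensorPower D n)
    (h1 : P 1) (hs : ∀ i (d : D), P (siteHom i d)) (hm : ∀ x y, P x → P y → P (x * y))
    (ha : ∀ x y, P x → P y → P (x + y)) (hc : ∀ (c : ℂ) x, P x → P (c • x)) : P x := by
  induction x using PiTensorProduct.induction_on with
  | add x y hx hy => exact ha _ _ hx hy
  | smul_tprod r x =>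
    refine hc _ _ ?_
    have key : ∀ s : Finset (Fin n), P (PiTensorProduct.tprod ℂ (fun i => if i ∈ s then x i else 1)) := by
      intro s
      induction s using Finset.induction_on with
      | empty => simpa [PiTensorProduct.one_def, Pi.one_def] using h1
      | insert a s has ih =>
        have := hm _ _ (hs a (x a)) ih
        rw [siteHom_apply, tprod_mul_tprod] at this
        convert this using 2
        ext j
        by_cases hj : j = a
        · subst hj; simp [has]
        · simp [hj]
    simpa using key Finset.univ

theorem bddAbove_repNorms {n : ℕ} (x : AlgTensorPower D n) : BddAbove (repNorms x) := by
  suffices h : ∃ C : ℝ, 0 ≤ C ∧ ∀ (H : Type u) (_ : NormedAddCommGroup H)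
      (_ : InnerProductSpace ℂ H) (_ : CompleteSpace H)
      (π : AlgTensorPower D n →⋆ₐ[ℂ] (H →L[ℂ] H)), ‖π x‖ ≤ C by
    obtain ⟨C, -, hC⟩ := h
    refine ⟨C, ?_⟩
    rintro r ⟨H, _, _, _, π, rfl⟩
    exact hC H _ _ _ π
  induction x using algTensor_ind with
  | h1 => exact ⟨1, zero_le_one, fun H _ _ _ π => by
      rw [map_one]; exact ContinuousLinearMap.norm_id_le⟩
  | hs i d => exact ⟨‖d‖, norm_nonneg _, fun H _ _ _ π =>
      NonUnitalStarAlgHom.norm_apply_le (π.comp (siteHom i)) d⟩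
  | hm x y hx hy =>
    obtain ⟨C, h0, hC⟩ := hx
    obtain ⟨C', h0', hC'⟩ := hy
    refine ⟨C * C', mul_nonneg h0 h0', fun H _ _ _ π => ?_⟩
    rw [map_mul]
    exact (norm_mul_le _ _).trans (mul_le_mul (hC H _ _ _ π) (hC' H _ _ _ π) (norm_nonneg _) h0)
  | ha x y hx hy =>
    obtain ⟨C, h0, hC⟩ := hx
    obtain ⟨C', h0', hC'⟩ := hy
    refine ⟨C + C', add_nonneg h0 h0', fun H _ _ _ π => ?_⟩
    rw [map_add]
    exact (norm_add_le _ _).trans (add_le_add (hC H _ _ _ π) (hC' H _ _ _ π))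
  | hc c x hx =>
    obtain ⟨C, h0, hC⟩ := hx
    refine ⟨‖c‖ * C, mul_nonneg (norm_nonneg _) h0, fun H _ _ _ π => ?_⟩
    rw [map_smul, norm_smul]
    exact mul_le_mul_of_nonneg_left (hC H _ _ _ π) (norm_nonneg _)

theorem extend_update_one {m n : ℕ} (e : Fin m ↪ Fin n) (x : Fin m → D) (i : Fin m) (c : D) :
    extend e (update x i c) 1 = update (extend e x 1) (e i) c := by
  ext j
  by_cases hj : ∃ k, e k = j
  · obtain ⟨k, rfl⟩ := hj
    rw [e.injective.extend_apply]
    by_cases hk : k = i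
    · subst hk; simp
    · rw [update_of_ne hk, update_of_ne (by simpa using hk), e.injective.extend_apply]
  · rw [extend_apply' _ _ _ hj, update_of_ne (fun h => hj ⟨i, h.symm⟩), extend_apply' _ _ _ hj]

theorem extend_comp_one {m n : ℕ} (e : Fin m ↪ Fin n) (g : D → D) (hg : g 1 = 1)
    (x : Fin m → D) : extend e (fun i => g (x i)) 1 = fun j => g (extend e x 1 j) := by
  ext j
  by_cases hj : ∃ k, e k = j
  · obtain ⟨k, rfl⟩ := hj
    simp [e.injective.extend_apply]
  · simp [extend_apply' _ _ _ hj, hg]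

/-- The multilinear map underlying `algTensorMap`. -/
def extendTprod {m n : ℕ} (e : Fin m ↪ Fin n) :
    MultilinearMap ℂ (fun _ : Fin m => D) (AlgTensorPower D n) where
  toFun x := PiTensorProduct.tprod ℂ (extend e x 1)
  map_update_add' x i a b := by
    rename_i inst
    rw [Subsingleton.elim inst (instDecidableEqFin m)]
    simp only [extend_update_one, MultilinearMap.map_update_add]
  map_update_smul' x i c a := by
    rename_i inst
    rw [Subsingleton.elim inst (instDecidableEqFin m)]
    simp only [extend_update_one, MultilinearMap.map_update_smul]

theorem extendTprod_apply {m n : ℕ} (e : Fin m ↪ Fin n) (x : Fin m → D) :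
    extendTprod e x = PiTensorProduct.tprod ℂ (extend e x 1) := rfl

/-- An injection `e` of index sets maps `⊗ᵢ xᵢ` to the elementary tensor with `xᵢ` at the place
`e i` and with `1` at all places outside the range of `e`. -/
def algTensorMap {m n : ℕ} (e : Fin m ↪ Fin n) :
    AlgTensorPower D m →⋆ₐ[ℂ] AlgTensorPower D n where
  __ := liftAlgHom (R := ℂ) (A := fun _ : Fin m => D) (extendTprod e)
    (by
      rw [extendTprod_apply, PiTensorProduct.one_def]
      exact congrArg (PiTensorProduct.tprod ℂ) (extend_comp_one (D := D) e (fun _ => 1) rfl 1 :))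
    (fun x y => by
      simp only [extendTprod_apply, tprod_mul_tprod]
      congr 1
      ext j
      by_cases hj : ∃ k, e k = j
      · obtain ⟨k, rfl⟩ := hj
        simp [e.injective.extend_apply]
      · simp [extend_apply' _ _ _ hj])
  map_star' x := by
    change PiTensorProduct.lift (extendTprod e) (star x) =
      star (PiTensorProduct.lift (extendTprod e) x)
    induction x using PiTensorProduct.induction_on with
    | smul_tprod r x =>
      rw [star_smul_tprod, map_smul, map_smul, lift.tprod, lift.tprod, extendTprod_apply,
        extendTprod_apply, star_smul_tprod]
      exact congrArg (fun z => star r • PiTensorProduct.tprod ℂ z) (extend_comp_one e star (star_one D) x)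
    | add x y hx hy => rw [star_add, map_add, map_add, star_add, hx, hy]

@[simp]
theorem algTensorMap_tprod {m n : ℕ} (e : Fin m ↪ Fin n) (x : Fin m → D) :
    algTensorMap e (PiTensorProduct.tprod ℂ x) = PiTensorProduct.tprod ℂ (extend e x 1) :=
  lift.tprod x

theorem algTensorMap_algTensorMap {l m n : ℕ} (e : Fin l ↪ Fin m) (e' : Fin m ↪ Fin n)
    (x : AlgTensorPower D l) :
    algTensorMap e' (algTensorMap e x) = algTensorMap (e.trans e') x := by
  induction x using PiTensorProduct.induction_on with
  | smul_tprod r x =>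
    simp only [map_smul, algTensorMap_tprod]
    congr 2
    ext j
    by_cases hj : ∃ k, e' k = j
    · obtain ⟨k, rfl⟩ := hj
      rw [e'.injective.extend_apply]
      by_cases hk : ∃ l, e l = k
      · obtain ⟨l, rfl⟩ := hk
        rw [e.injective.extend_apply]
        exact ((e.trans e').injective.extend_apply x 1 l).symm
      · rw [extend_apply' _ _ _ hk, extend_apply']
        · rfl
        · rintro ⟨l, hl⟩; exact hk ⟨l, e'.injective hl⟩
    · rw [extend_apply' _ _ _ hj, extend_apply']
      rintro ⟨l, hl⟩; exact hj ⟨e l, hl⟩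
  | add x y hx hy => simp only [map_add, hx, hy]

theorem algTensorMap_refl {m : ℕ} (x : AlgTensorPower D m) :
    algTensorMap (Embedding.refl _) x = x := by
  induction x using PiTensorProduct.induction_on with
  | smul_tprod r x =>
    simp only [map_smul, algTensorMap_tprod]
    congr 2
    ext j
    exact (Embedding.refl (Fin m)).injective.extend_apply x 1 j
  | add x y hx hy => simp only [map_add, hx, hy]

/-- The maximal C*-norm on the algebraic tensor power: the supremum of `‖π x‖` over all
`*`-representations `π` of the algebraic tensor power. -/
def maxNorm (D : Type u) [CStarAlgebra D] (n : ℕ) : CStarSeminorm (AlgTensorPower D n) :=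
  universalSeminorm bddAbove_repNorms

/-- The maximal tensor power `Dⁿ`: the completion of the algebraic tensor power in the maximal
C*-norm. -/
abbrev MaxTensorPower (D : Type u) [CStarAlgebra D] (n : ℕ) : Type u := (maxNorm D n).Completion

namespace MaxTensorPower

/-- The elementary tensor `x₁ ⊗ ⋯ ⊗ xₙ` in `Dⁿ`. -/
def elem {n : ℕ} (x : Fin n → D) : MaxTensorPower D n := (maxNorm D n).toCompletion (PiTensorProduct.tprod ℂ x)

theorem maxNorm_algTensorMap_le {m n : ℕ} (e : Fin m ↪ Fin n) (x : AlgTensorPower D m) :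
    (maxNorm D n).toSeminorm (algTensorMap e x) ≤ (maxNorm D m).toSeminorm x := by
  refine csSup_le (repNorms_nonempty _) ?_
  rintro r ⟨H, _, _, _, π, rfl⟩
  exact le_universalSeminorm bddAbove_repNorms (π.comp (algTensorMap e)) x

/-- The extension of `algTensorMap` to the maximal tensor powers. -/
def map {m n : ℕ} (e : Fin m ↪ Fin n) : MaxTensorPower D m →⋆ₐ[ℂ] MaxTensorPower D n :=
  (maxNorm D m).lift ((maxNorm D n).toCompletion.comp (algTensorMap e)) fun x =>
    (CStarSeminorm.norm_toCompletion _ _).trans_le (maxNorm_algTensorMap_le e x)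

@[simp]
theorem map_toCompletion {m n : ℕ} (e : Fin m ↪ Fin n) (x : AlgTensorPower D m) :
    map e ((maxNorm D m).toCompletion x) = (maxNorm D n).toCompletion (algTensorMap e x) :=
  CStarSeminorm.lift_toCompletion _ _ _ _

@[simp]
theorem map_elem {m n : ℕ} (e : Fin m ↪ Fin n) (x : Fin m → D) :
    map e (elem x) = elem (extend e x 1) := by
  rw [elem, map_toCompletion, algTensorMap_tprod, elem]

theorem continuous_map {m n : ℕ} (e : Fin m ↪ Fin n) : Continuous (map (D := D) e) :=
  map_continuous _

theorem map_map {l m n : ℕ} (e : Fin l ↪ Fin m) (e' : Fin m ↪ Fin n) (x : MaxTensorPower D l) :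
    map e' (map e x) = map (e.trans e') x := by
  induction x using (maxNorm D l).denseRange_toCompletion.induction_on with
  | hp => exact isClosed_eq ((continuous_map e').comp (continuous_map e)) (continuous_map _)
  | ih a => simp only [map_toCompletion, algTensorMap_algTensorMap]

theorem map_refl {m : ℕ} (x : MaxTensorPower D m) : map (Embedding.refl _) x = x := by
  induction x using (maxNorm D m).denseRange_toCompletion.induction_on with
  | hp => exact isClosed_eq (continuous_map _) continuous_id
  | ih a => rw [map_toCompletion, algTensorMap_refl]

/-- The automorphism `α_π` of `Dⁿ` with
`α_π (x₁ ⊗ ⋯ ⊗ xₙ) = x_{π 1} ⊗ ⋯ ⊗ x_{π n}` (see `permute_elem`). -/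
def permute {n : ℕ} (π : Equiv.Perm (Fin n)) : MaxTensorPower D n →⋆ₐ[ℂ] MaxTensorPower D n :=
  map π.symm.toEmbedding

theorem permute_elem {n : ℕ} (π : Equiv.Perm (Fin n)) (x : Fin n → D) :
    permute π (elem x) = elem (x ∘ π) := by
  rw [permute, map_elem]
  congr 1
  ext j
  have h := π.symm.injective.extend_apply x 1 (π j)
  rwa [Equiv.symm_apply_apply] at h

/-- The embedding `x ↦ x ⊗ 1 ⊗ ⋯ ⊗ 1` of `Dᵐ` into `Dⁿ`, for `m ≤ n`. -/
def incl (m n : ℕ) (h : m ≤ n) : MaxTensorPower D m →⋆ₐ[ℂ] MaxTensorPower D n :=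
  map (Fin.castLEEmb h)

instance : DirectedSystem (MaxTensorPower D) (incl (D := D) · · ·) where
  map_self _ x := map_refl x
  map_map _ _ _ hij hjk x := map_map (Fin.castLEEmb hij) (Fin.castLEEmb hjk) x

end MaxTensorPower

/-! ### The infinite maximal tensor power -/

/-- The infinite maximal tensor power `D^∞`, the C*-algebraic inductive limit of the `Dⁿ`. -/
abbrev InfMaxTensorPower (D : Type u) [CStarAlgebra D] : Type u :=
  CStarIndLim.Limit (MaxTensorPower.incl (D := D))

namespace InfMaxTensorPower

/-- The canonical map `Dⁿ → D^∞`. -/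
def ofPow (n : ℕ) : MaxTensorPower D n →⋆ₐ[ℂ] InfMaxTensorPower D :=
  CStarIndLim.of MaxTensorPower.incl n

theorem ofPow_incl (m n : ℕ) (h : m ≤ n) (x : MaxTensorPower D m) :
    ofPow n (MaxTensorPower.incl m n h x) = ofPow m x :=
  CStarIndLim.of_f _ m n h x

/-- For `π ∈ Sₙ`, the place (among the first `max m n`) to which `α_π` moves the `i`-th tensor
factor: `π⁻¹ i` if `i < n`, and `i` otherwise. -/
def permIndex {n : ℕ} (π : Equiv.Perm (Fin n)) (m : ℕ) : Fin m ↪ Fin (max m n) where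
  toFun i := if h : (i : ℕ) < n then Fin.castLE (le_max_right m n) (π.symm ⟨i, h⟩)
    else Fin.castLE (le_max_left m n) i
  inj' i j hij := by
    by_cases hi : (i : ℕ) < n <;> by_cases hj : (j : ℕ) < n <;>
      simp only [hi, hj, dite_true, dite_false] at hij
    · have := π.symm.injective (Fin.castLE_injective _ hij)
      exact Fin.ext (by simpa using this)
    · exact absurd (congrArg Fin.val hij) (by
        have := (π.symm ⟨i, hi⟩).isLt
        simp only [Fin.val_castLE]; omega)
    · exact absurd (congrArg Fin.val hij) (by
        have := (π.symm ⟨j, hj⟩).isLt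
        simp only [Fin.val_castLE]; omega)
    · exact Fin.castLE_injective _ hij

theorem val_permIndex {n : ℕ} (π : Equiv.Perm (Fin n)) (m : ℕ) (i : Fin m) :
    (permIndex π m i : ℕ) = if h : (i : ℕ) < n then (π.symm ⟨i, h⟩ : ℕ) else i := by
  change Fin.val (dite _ _ _) = _
  split <;> rfl

/-- The action `α_π` of `π ∈ Sₙ` on `D^∞`, permuting the first `n` tensor factors. -/
def permute {n : ℕ} (π : Equiv.Perm (Fin n)) : InfMaxTensorPower D →⋆ₐ[ℂ] InfMaxTensorPower D :=
  CStarIndLim.lift MaxTensorPower.incl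
    (fun m => (ofPow (max m n)).comp (MaxTensorPower.map (permIndex π m)))
    (fun i j h x => by
      have h' : max i n ≤ max j n := max_le_max_right n h
      change ofPow (max i n) (MaxTensorPower.map (permIndex π i) x) =
        ofPow (max j n) (MaxTensorPower.map (permIndex π j) (MaxTensorPower.map _ x))
      rw [← ofPow_incl (max i n) (max j n) h', MaxTensorPower.incl, MaxTensorPower.map_map,
        MaxTensorPower.map_map]
      congr 3
      ext k
      simp [val_permIndex])

/-- On `D^{n+k}`, the map `α_π` with `π ∈ Sₙ` is the permutation of the first `n` factors. -/
theorem permute_ofPow {n : ℕ} (π : Equiv.Perm (Fin n)) (k : ℕ) (x : MaxTensorPower D (n + k)) :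
    permute π (ofPow (n + k) x) = ofPow (n + k)
      (MaxTensorPower.permute
      ((finSumFinEquiv.symm.trans (Equiv.sumCongr π (Equiv.refl (Fin k)))).trans finSumFinEquiv)
      x) := by
  rw [permute, ofPow, CStarIndLim.lift_of]
  have h' : n + k ≤ max (n + k) n := le_max_left _ _
  change ofPow (max (n + k) n) (MaxTensorPower.map (permIndex π (n + k)) x) = ofPow (n + k) _
  rw [← ofPow_incl (n + k) (max (n + k) n) h', MaxTensorPower.incl, MaxTensorPower.permute,
    MaxTensorPower.map_map]
  congr 3
  ext i
  refine Fin.addCases (fun i => ?_) (fun i => ?_) i <;> simp [val_permIndex]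

end InfMaxTensorPower

end AlgTensor

/-! ### States -/

/-- A state on a unital C*-algebra: a normalized positive linear functional. -/
structure State (A : Type u) [CStarAlgebra A] where
  toLinearMap : A →ₗ[ℂ] ℂ
  map_one' : toLinearMap 1 = 1
  nonneg' : ∀ x, 0 ≤ toLinearMap (star x * x)

namespace State

variable {A : Type u} [CStarAlgebra A]

instance : FunLike (State A) A ℂ where
  coe σ := σ.toLinearMap
  coe_injective σ τ h := by
    cases σ; cases τ; congr; exact DFunLike.coe_injective h

instance : LinearMapClass (State A) ℂ A ℂ where
  map_add σ := σ.toLinearMap.map_add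
  map_smulₛₗ σ := σ.toLinearMap.map_smul

/-- The weak-* topology: the coarsest one for which all evaluations `σ ↦ σ x` are continuous. -/
instance : TopologicalSpace (State A) :=
  TopologicalSpace.induced (fun (σ : State A) (x : A) => σ x) inferInstance

/-- The state space carries its Borel `σ`-algebra. -/
instance : MeasurableSpace (State A) := borel (State A)

instance : BorelSpace (State A) := ⟨rfl⟩

end State

/-! ### The GNS representation of a positive functional on a `*`-algebra -/

section GNS

variable {A : Type u} [Ring A] [StarRing A] [Algebra ℂ A] [StarModule ℂ A]

theorem map_star_of_pos (φ : A →ₗ[ℂ] ℂ) (hφ : ∀ x, 0 ≤ φ (star x * x)) (x : A) :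
    φ (star x) = star (φ x) := by
  have key : ∀ y : A, (φ y).im + (φ (star y)).im = 0 := fun y => by
    have h1 := (Complex.nonneg_iff.mp (hφ (y + 1))).2
    have h2 := (Complex.nonneg_iff.mp (hφ y)).2
    have h3 := (Complex.nonneg_iff.mp (hφ 1)).2
    simp only [star_add, star_one, add_mul, mul_add, mul_one, one_mul, map_add,
      Complex.add_im] at h1 h2 h3
    linarith
  have h1 := key x
  have h2 := key (Complex.I • x)
  simp only [star_smul, map_smul, smul_eq_mul, Complex.star_def, Complex.conj_I,
    Complex.mul_im, Complex.I_re, Complex.I_im, Complex.neg_re, Complex.neg_im] at h2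
  apply Complex.ext
  · simp; linarith
  · simp; linarith

/-- A positive functional on a `*`-algebra. -/
structure PosFunctional (A : Type u) [Ring A] [StarRing A] [Algebra ℂ A] where
  toLinearMap : A →ₗ[ℂ] ℂ
  nonneg' : ∀ x, 0 ≤ toLinearMap (star x * x)

namespace PosFunctional

/-- The algebra with the semi-inner product `⟪x, y⟫ = φ (x* y)`. -/
def PreGNS (_φ : PosFunctional A) : Type u := A

variable (φ : PosFunctional A)

instance : AddCommGroup φ.PreGNS := inferInstanceAs (AddCommGroup A)
instance : Module ℂ φ.PreGNS := inferInstanceAs (Module ℂ A)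

/-- The identity map to the pre-Hilbert space. -/
def toPre : A ≃ₗ[ℂ] φ.PreGNS := LinearEquiv.refl ℂ A

/-- The semi-inner product. -/
abbrev core : PreInnerProductSpace.Core ℂ φ.PreGNS where
  inner x y := φ.toLinearMap (star (φ.toPre.symm x) * φ.toPre.symm y)
  conj_inner_symm x y := by
    rw [← Complex.star_def, ← map_star_of_pos _ φ.nonneg', star_mul, star_star]
  re_inner_nonneg x := (Complex.nonneg_iff.mp (φ.nonneg' _)).1
  add_left x y z := by simp only [map_add, star_add, add_mul]
  smul_left x y r := by
    simp only [map_smul, star_smul, smul_mul_assoc, smul_eq_mul, Complex.star_def]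

instance : SeminormedAddCommGroup φ.PreGNS :=
  InnerProductSpace.Core.toSeminormedAddCommGroup (c := φ.core)
instance : InnerProductSpace ℂ φ.PreGNS := InnerProductSpace.ofCore φ.core

theorem inner_def (x y : φ.PreGNS) :
    inner ℂ x y = φ.toLinearMap (star (φ.toPre.symm x) * φ.toPre.symm y) := rfl

theorem normSq_def (x : A) : ‖φ.toPre x‖ ^ 2 = (φ.toLinearMap (star x * x)).re := by
  rw [← inner_self_eq_norm_sq (𝕜 := ℂ)]; rfl

variable (hb : ∀ a : A, ∃ C : ℝ, ∀ x : A, ‖φ.toPre (a * x)‖ ≤ C * ‖φ.toPre x‖)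

/-- Left multiplication on the pre-Hilbert space. -/
def leftMul (a : A) : φ.PreGNS →L[ℂ] φ.PreGNS :=
  LinearMap.mkContinuousOfExistsBound
    (φ.toPre.toLinearMap ∘ₗ LinearMap.mulLeft ℂ a ∘ₗ φ.toPre.symm.toLinearMap) (hb a)

theorem leftMul_apply (a x : A) : φ.leftMul hb a (φ.toPre x) = φ.toPre (a * x) := rfl

/-- The Hilbert space of the GNS representation. -/
abbrev GNS : Type u := UniformSpace.Completion φ.PreGNS

theorem gns_ext {S T : φ.GNS →L[ℂ] φ.GNS}
    (h : ∀ x : A, S (φ.toPre x : φ.GNS) = T (φ.toPre x : φ.GNS)) : S = T := by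
  ext y
  induction y using UniformSpace.Completion.induction_on with
  | hp => exact isClosed_eq S.continuous T.continuous
  | ih x => exact h x

/-- The action of an algebra element on the GNS space. -/
def gnsOp (a : A) : φ.GNS →L[ℂ] φ.GNS := (φ.leftMul hb a).completion

theorem gnsOp_coe (a x : A) :
    φ.gnsOp hb a (φ.toPre x : φ.GNS) = (φ.toPre (a * x) : φ.GNS) :=
  UniformSpace.Completion.map_coe (φ.leftMul hb a).uniformContinuous _

/-- The GNS representation. -/
def gns : A →⋆ₐ[ℂ] (φ.GNS →L[ℂ] φ.GNS) where
  toFun := φ.gnsOp hb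
  map_one' := φ.gns_ext fun x => by rw [gnsOp_coe, one_mul]; rfl
  map_mul' a b := φ.gns_ext fun x => by
    rw [gnsOp_coe, mul_apply_eq_comp, gnsOp_coe, gnsOp_coe, mul_assoc]
  map_zero' := φ.gns_ext fun x => by
    rw [gnsOp_coe, zero_mul, map_zero]; exact UniformSpace.Completion.coe_zero
  map_add' a b := φ.gns_ext fun x => by
    rw [gnsOp_coe, add_apply, gnsOp_coe, gnsOp_coe, add_mul, map_add,
      UniformSpace.Completion.coe_add]
  commutes' r := φ.gns_ext fun x => by
    rw [gnsOp_coe, ← Algebra.smul_def, map_smul, UniformSpace.Completion.coe_smul,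
      Algebra.algebraMap_eq_smul_one]; rfl
  map_star' a := by
    refine (ContinuousLinearMap.eq_adjoint_iff _ _).mpr fun x y => ?_
    induction x, y using UniformSpace.Completion.induction_on₂ with
    | hp => apply isClosed_eq <;> fun_prop
    | ih x y =>
      obtain ⟨x, rfl⟩ := φ.toPre.surjective x
      obtain ⟨y, rfl⟩ := φ.toPre.surjective y
      change inner ℂ (φ.gnsOp hb (star a) (φ.toPre x : φ.GNS)) (φ.toPre y : φ.GNS) =
        inner ℂ (φ.toPre x : φ.GNS) (φ.gnsOp hb a (φ.toPre y : φ.GNS))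
      rw [gnsOp_coe, gnsOp_coe, UniformSpace.Completion.inner_coe,
        UniformSpace.Completion.inner_coe, inner_def, inner_def]
      simp only [LinearEquiv.symm_apply_apply, star_mul, star_star, mul_assoc]

theorem inner_gns (a : A) :
    inner ℂ (φ.toPre 1 : φ.GNS) (φ.gns hb a (φ.toPre 1 : φ.GNS)) = φ.toLinearMap a := by
  change inner ℂ (φ.toPre 1 : φ.GNS) (φ.gnsOp hb a (φ.toPre 1 : φ.GNS)) = _
  rw [gnsOp_coe, UniformSpace.Completion.inner_coe, inner_def]
  simp

/-- A normalized positive functional is bounded by the universal C*-seminorm. -/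
theorem norm_le_universal
    (hb : ∀ a : A, ∃ C : ℝ, ∀ x : A, ‖φ.toPre (a * x)‖ ≤ C * ‖φ.toPre x‖)
    (h : ∀ x : A, BddAbove (repNorms x)) (h1 : φ.toLinearMap 1 = 1) (a : A) :
    ‖φ.toLinearMap a‖ ≤ (universalSeminorm h).toSeminorm a := by
  have hΩ : ‖(φ.toPre 1 : φ.GNS)‖ = 1 := by
    rw [UniformSpace.Completion.norm_coe]
    have := φ.normSq_def 1
    rw [star_one, one_mul, h1, Complex.one_re] at this
    nlinarith [norm_nonneg (φ.toPre 1)]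
  rw [← inner_gns φ hb a]
  refine (norm_inner_le_norm _ _).trans ?_
  refine (mul_le_mul_of_nonneg_left ((φ.gns hb a).le_opNorm _) (norm_nonneg _)).trans ?_
  rw [hΩ, one_mul, mul_one]
  exact le_universalSeminorm h (φ.gns hb) a

end PosFunctional

end GNS

/-! ### Product states -/

section ProductState

variable {D : Type u} [CStarAlgebra D] (σ : State D)

open PiTensorProduct hiding tprod

/-- The linear functional `x₁ ⊗ ⋯ ⊗ xₙ ↦ σ x₁ ⋯ σ xₙ` on the algebraic tensor power. -/
def algProd (n : ℕ) : AlgTensorPower D n →ₗ[ℂ] ℂ :=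
  PiTensorProduct.lift
    ((MultilinearMap.mkPiAlgebra ℂ (Fin n) ℂ).compLinearMap fun _ => σ.toLinearMap)

@[simp]
theorem algProd_tprod {n : ℕ} (x : Fin n → D) :
    algProd σ n (PiTensorProduct.tprod ℂ x) = ∏ i, σ (x i) := by
  rw [algProd, PiTensorProduct.lift.tprod]
  simp
  rfl

theorem algProd_one (n : ℕ) : algProd σ n 1 = 1 := by
  rw [PiTensorProduct.one_def, algProd_tprod]
  exact Finset.prod_eq_one fun i _ => σ.map_one'

theorem algProd_algTensorMap {m n : ℕ} (e : Fin m ↪ Fin n) (x : AlgTensorPower D m) :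
    algProd σ n (algTensorMap e x) = algProd σ m x := by
  induction x using PiTensorProduct.induction_on with
  | smul_tprod r x =>
    rw [map_smul, map_smul, map_smul, algTensorMap_tprod, algProd_tprod, algProd_tprod]
    congr 1
    rw [← Finset.prod_subset (Finset.subset_univ (Finset.univ.map e))]
    · rw [Finset.prod_map]
      exact Finset.prod_congr rfl fun i _ => by rw [e.injective.extend_apply]
    · intro j _ hj
      rw [Function.extend_apply' _ _ _ (by simpa using hj)]
      exact σ.map_one'
  | add x y hx hy => rw [map_add, map_add, map_add, hx, hy]

theorem posSemidef_site {n : ℕ} (i : Fin n) :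
    (Matrix.of fun x y : Fin n → D => σ (star (x i) * y i)).PosSemidef := by
  refine ⟨?_, fun c => ?_⟩
  · ext x y
    rw [Matrix.conjTranspose_apply, Matrix.of_apply, Matrix.of_apply]
    have := map_star_of_pos σ.toLinearMap σ.nonneg' (star (y i) * x i)
    rw [star_mul, star_star] at this
    exact this.symm
  · have := σ.nonneg' (c.sum fun x r => r • x i)
    refine this.trans_eq ?_
    simp only [Finsupp.sum, star_sum, star_smul, Finset.sum_mul, Finset.mul_sum, map_sum,
      smul_mul_assoc, mul_smul_comm, map_smul, smul_eq_mul, Matrix.of_apply]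
    rw [Finset.sum_comm]
    refine Finset.sum_congr rfl fun x _ => Finset.sum_congr rfl fun y _ => ?_
    change _ = star (c x) * σ.toLinearMap (star (x i) * y i) * c y
    ring

theorem posSemidef_prod {n : ℕ} (s : Finset (Fin n)) :
    (Matrix.of fun x y : Fin n → D => ∏ i ∈ s, σ (star (x i) * y i)).PosSemidef := by
  induction s using Finset.induction_on with
  | empty =>
    refine ⟨by ext; simp, fun c => ?_⟩
    have := star_mul_self_nonneg (c.sum fun _ r => r)
    refine this.trans_eq ?_
    simp only [Finsupp.sum, star_sum, Finset.sum_mul, Finset.mul_sum, Matrix.of_apply,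
      Finset.prod_empty, mul_one]
    exact Finset.sum_comm
  | insert a s has ih =>
    have h : (Matrix.of fun x y : Fin n → D => ∏ i ∈ insert a s, σ (star (x i) * y i)) =
        (Matrix.of fun x y : Fin n → D => σ (star (x a) * y a)).hadamard
          (Matrix.of fun x y : Fin n → D => ∏ i ∈ s, σ (star (x i) * y i)) := by
      ext x y
      simp [Finset.prod_insert has]
    rw [h]
    exact (posSemidef_site σ a).hadamard ih

theorem algProd_nonneg {n : ℕ} (x : AlgTensorPower D n) : 0 ≤ algProd σ n (star x * x) := by
  have hx : x ∈ Submodule.span ℂ (Set.range (PiTensorProduct.tprod ℂ (s := fun _ : Fin n => D))) :=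
    by rw [PiTensorProduct.span_tprod_eq_top]; trivial
  obtain ⟨c, rfl⟩ := Finsupp.mem_span_range_iff_exists_finsupp.mp hx
  refine ((posSemidef_prod σ Finset.univ).2 c).trans_eq ?_
  simp only [Finsupp.sum, star_sum, Finset.sum_mul, Finset.mul_sum, map_sum, star_smul, star_tprod,
    smul_mul_assoc, mul_smul_comm, map_smul, smul_eq_mul, Matrix.of_apply, tprod_mul_tprod,
    algProd_tprod, Pi.mul_apply, Pi.star_apply]
  rw [Finset.sum_comm]
  refine Finset.sum_congr rfl fun x _ => Finset.sum_congr rfl fun y _ => ?_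
  ring

/-- The product functional on the algebraic tensor power, as a positive functional. -/
def algProdPos (n : ℕ) : PosFunctional (AlgTensorPower D n) := ⟨algProd σ n, algProd_nonneg σ⟩

theorem algProd_bdd {n : ℕ} (a : AlgTensorPower D n) : ∃ C : ℝ, ∀ x : AlgTensorPower D n,
    ‖(algProdPos σ n).toPre (a * x)‖ ≤ C * ‖(algProdPos σ n).toPre x‖ := by
  suffices h : ∃ C : ℝ, 0 ≤ C ∧ ∀ x : AlgTensorPower D n,
      ‖(algProdPos σ n).toPre (a * x)‖ ≤ C * ‖(algProdPos σ n).toPre x‖ from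
    h.imp fun _ h => h.2
  induction a using algTensor_ind with
  | h1 => exact ⟨1, zero_le_one, fun x => by rw [one_mul, one_mul]⟩
  | hs i d =>
    refine ⟨‖d‖, norm_nonneg _, fun x => ?_⟩
    let _ := CStarAlgebra.spectralOrder D
    let _ := CStarAlgebra.spectralOrderedRing D
    obtain ⟨e, he⟩ := CStarAlgebra.nonneg_iff_eq_star_mul_self.mp
      (sub_nonneg.mpr (CStarAlgebra.star_mul_le_algebraMap_norm_sq (a := d)))
    refine (sq_le_sq₀ (norm_nonneg _) (by positivity)).mp ?_
    have h0 := (Complex.nonneg_iff.mp (algProd_nonneg σ (siteHom i e * x))).1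
    have h1 : star (siteHom i e * x) * (siteHom i e * x) =
        ((‖d‖ ^ 2 : ℝ) : ℂ) • (star x * x) - star (siteHom i d * x) * (siteHom i d * x) := by
      have h2 : ∀ y : D, star (siteHom i y * x) * (siteHom i y * x) =
          star x * siteHom i (star y * y) * x := fun y => by
        rw [star_mul, map_mul, map_star, mul_assoc, mul_assoc, mul_assoc]
      rw [h2, h2, ← he, map_sub, mul_sub, sub_mul, IsScalarTower.algebraMap_apply ℝ ℂ D,
        AlgHomClass.commutes, Algebra.algebraMap_eq_smul_one, mul_smul_comm, mul_one,
        smul_mul_assoc]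
      rfl
    rw [h1, map_sub, map_smul, smul_eq_mul, Complex.sub_re, Complex.re_ofReal_mul] at h0
    rw [mul_pow, PosFunctional.normSq_def, PosFunctional.normSq_def]
    exact sub_nonneg.mp h0
  | hm a b ha hb =>
    obtain ⟨C, h0, hC⟩ := ha
    obtain ⟨C', h0', hC'⟩ := hb
    refine ⟨C * C', mul_nonneg h0 h0', fun x => ?_⟩
    rw [mul_assoc, mul_assoc]
    exact (hC _).trans (mul_le_mul_of_nonneg_left (hC' x) h0)
  | ha a b ha hb =>
    obtain ⟨C, h0, hC⟩ := ha
    obtain ⟨C', h0', hC'⟩ := hb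
    refine ⟨C + C', add_nonneg h0 h0', fun x => ?_⟩
    rw [add_mul, add_mul, map_add]
    exact (norm_add_le _ _).trans (add_le_add (hC x) (hC' x))
  | hc c a ha =>
    obtain ⟨C, h0, hC⟩ := ha
    refine ⟨‖c‖ * C, mul_nonneg (norm_nonneg _) h0, fun x => ?_⟩
    rw [smul_mul_assoc, map_smul, norm_smul, mul_assoc]
    exact mul_le_mul_of_nonneg_left (hC x) (norm_nonneg _)

theorem norm_algProd_le {n : ℕ} (x : AlgTensorPower D n) :
    ‖algProd σ n x‖ ≤ (maxNorm D n).toSeminorm x :=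
  (algProdPos σ n).norm_le_universal (algProd_bdd σ) bddAbove_repNorms (algProd_one σ n) x

/-- The product functional on `Dⁿ`. -/
def powProd (n : ℕ) : MaxTensorPower D n →L[ℂ] ℂ :=
  CStarSeminorm.liftCLM (algProd σ n) (norm_algProd_le σ)

@[simp]
theorem powProd_toCompletion {n : ℕ} (x : AlgTensorPower D n) :
    powProd σ n ((maxNorm D n).toCompletion x) = algProd σ n x :=
  CStarSeminorm.liftCLM_toCompletion _ _ _ _

theorem norm_powProd_le {n : ℕ} (x : MaxTensorPower D n) : ‖powProd σ n x‖ ≤ ‖x‖ := by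
  induction x using (maxNorm D n).denseRange_toCompletion.induction_on with
  | hp => exact isClosed_le (by fun_prop) (by fun_prop)
  | ih a =>
    rw [powProd_toCompletion, CStarSeminorm.norm_toCompletion]
    exact norm_algProd_le σ a

theorem powProd_nonneg {n : ℕ} (x : MaxTensorPower D n) : 0 ≤ powProd σ n (star x * x) := by
  induction x using (maxNorm D n).denseRange_toCompletion.induction_on with
  | hp => exact isClosed_le continuous_const (by fun_prop)
  | ih a =>
    rw [← map_star, ← map_mul, powProd_toCompletion]
    exact algProd_nonneg σ a

theorem powProd_incl (m n : ℕ) (h : m ≤ n) (x : MaxTensorPower D m) :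
    powProd σ m x = powProd σ n (MaxTensorPower.incl m n h x) := by
  induction x using (maxNorm D m).denseRange_toCompletion.induction_on with
  | hp =>
    exact isClosed_eq (by fun_prop)
      ((powProd σ n).continuous.comp (MaxTensorPower.continuous_map _))
  | ih a =>
    rw [MaxTensorPower.incl, MaxTensorPower.map_toCompletion, powProd_toCompletion,
      powProd_toCompletion, algProd_algTensorMap]

/-- The product functional on `D^∞`. -/
def infProd : InfMaxTensorPower D →L[ℂ] ℂ :=
  CStarSeminorm.liftCLM
    (CStarIndLim.liftLocalLinear MaxTensorPower.incl (fun n => (powProd σ n).toLinearMap)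
      (powProd_incl σ))
    (DirectLimit.induction _ fun n x => by
      change ‖powProd σ n x‖ ≤ CStarIndLim.limNorm MaxTensorPower.incl n x
      refine ge_of_tendsto' (CStarIndLim.tendsto_limNorm MaxTensorPower.incl n x) fun k => ?_
      rw [powProd_incl σ n (n + k) (Nat.le_add_right n k) x]
      exact norm_powProd_le σ _)

theorem infProd_ofPow {n : ℕ} (x : MaxTensorPower D n) :
    infProd σ (InfMaxTensorPower.ofPow n x) = powProd σ n x :=
  CStarSeminorm.liftCLM_toCompletion _ _ _ _

/-- The infinite product state `Π_σ` on `D^∞`, with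
`Π_σ (x₁ ⊗ ⋯ ⊗ xₙ) = σ x₁ ⋯ σ xₙ` (see `productState_elem`). -/
def productState : State (InfMaxTensorPower D) where
  toLinearMap := (infProd σ).toLinearMap
  map_one' := by
    change infProd σ 1 = 1
    rw [← map_one (InfMaxTensorPower.ofPow 0), infProd_ofPow, ← map_one (maxNorm D 0).toCompletion,
      powProd_toCompletion, algProd_one]
  nonneg' x := by
    change 0 ≤ infProd σ (star x * x)
    induction x using CStarIndLim.of_ind with
    | hc => exact isClosed_le continuous_const (by fun_prop)
    | h n a =>
      change 0 ≤ infProd σ (star (InfMaxTensorPower.ofPow n a) * InfMaxTensorPower.ofPow n a)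
      rw [← map_star, ← map_mul, infProd_ofPow]
      exact powProd_nonneg σ a

theorem productState_elem {n : ℕ} (x : Fin n → D) :
    productState σ (InfMaxTensorPower.ofPow n (MaxTensorPower.elem x)) = ∏ i, σ (x i) := by
  change infProd σ _ = _
  rw [infProd_ofPow, MaxTensorPower.elem, powProd_toCompletion, algProd_tprod]

end ProductState

/-- A state `ρ` on `D^∞` is symmetric if `ρ (α_π x) = ρ x` for all `n`, all `π ∈ Sₙ` and all
`x ∈ D^∞`. -/
def State.IsSymmetric {D : Type u} [CStarAlgebra D] (ρ : State (InfMaxTensorPower D)) : Prop :=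
  ∀ (n : ℕ) (π : Equiv.Perm (Fin n)) (x : InfMaxTensorPower D),
    ρ x = ρ (InfMaxTensorPower.permute π x)

end QuantumDeFinetti

end

/-!
The proof represents `ρ` by a commutative algebra of "symmetrised single-site observables".

Since `ρ` is symmetric, its value at `d₁ ⊗ ⋯ ⊗ dₙ` does not depend on the order of the `dᵢ` nor on
the distinct tensor factors in which they are placed (`apply_siteProd`). So there is a linear
functional `momentFun ρ` on the commutative polynomial algebra in variables `X_d`, `d ∈ D`, with
`X_{d₁} ⋯ X_{dₙ} ↦ ρ (d₁ ⊗ ⋯ ⊗ dₙ)`; the algebra carries the involution `X_d ↦ X_{d*}`. One thinks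
of `X_d` as the limit of the averages of the copies of `d` in the first `N` factors.

Positivity comes from placing copies `c₁, c₂, …` of the same element in disjoint blocks of tensor
factors. All `ρ (cᵢ* cⱼ)` with `i ≠ j` have a common value, and this value is nonnegative because
its `N (N - 1)` occurrences dominate the expansion of `ρ (|c₁ + ⋯ + c_N|²) ≥ 0` as `N → ∞`
(`State.correlation_nonneg`). This gives `momentFun ρ (p* p) ≥ 0`, and, with a further factor
supported outside the blocks, that `X_{d*d}` and `X_{d*d} - X_{d*} X_d` are positive
(`momentFun_X_nonneg`, `momentFun_variance_nonneg`). Hence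
multiplication by `X_d` is bounded by `‖d‖` (`momentPos_bdd`), and the GNS representation of
`momentFun ρ` consists of bounded operators in which `X_d` is linear, unital and positive in `d`.

The norm closure of its range is a commutative C*-algebra, and each of its characters `χ` gives a
state `d ↦ χ (X_d)` of `D`. Composing Gelfand duality with this map from characters to states gives
a representation of `C(State D, ℂ)` in which the evaluation at `d` acts as `X_d`
(`exists_starAlgHom_of_positive`). The vacuum functional is therefore a positive functional on
`C(State D, ℂ)` that sends `σ ↦ σ d₁ ⋯ σ dₙ` to `ρ (d₁ ⊗ ⋯ ⊗ dₙ)`, and the Riesz–Markov–Kakutani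
theorem gives the measure. The formula extends from elementary tensors to `D^∞` by density
(`mem_of_isClosed`). Uniqueness holds because, by Stone–Weierstrass, the functions
`σ ↦ σ d₁ ⋯ σ dₙ` span a dense subspace of `C(State D, ℂ)` (`mem_of_prod_evalMap_mem`).
-/

noncomputable section

namespace QuantumDeFinetti

open Topology MeasureTheory Filter
open scoped TensorProduct ComplexOrder CStarAlgebra

set_option linter.unusedSectionVars false

universe u

/-! ### States of a C*-algebra and the compactness of the state space -/

namespace State

variable {A : Type u} [CStarAlgebra A]

theorem map_one (σ : State A) : σ 1 = 1 := σ.map_one'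

theorem nonneg (σ : State A) (x : A) : 0 ≤ σ (star x * x) := σ.nonneg' x

theorem map_star (σ : State A) (x : A) : σ (star x) = star (σ x) :=
  map_star_of_pos σ.toLinearMap σ.nonneg' x

/-- Applying `σ` to `‖x‖² - x* x = e* e ≥ 0`. -/
theorem star_mul_self_le (σ : State A) (x : A) : (σ (star x * x)).re ≤ ‖x‖ ^ 2 := by
  let _ := CStarAlgebra.spectralOrder A
  let _ := CStarAlgebra.spectralOrderedRing A
  obtain ⟨e, he⟩ := CStarAlgebra.nonneg_iff_eq_star_mul_self.mp
    (sub_nonneg.mpr (CStarAlgebra.star_mul_le_algebraMap_norm_sq (a := x)))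
  have h := (Complex.nonneg_iff.mp (σ.nonneg e)).1
  rw [← he, IsScalarTower.algebraMap_apply ℝ ℂ A, Algebra.algebraMap_eq_smul_one, map_sub,
    map_smul, σ.map_one] at h
  have h1 : ((algebraMap ℝ ℂ) (‖x‖ ^ 2) • (1 : ℂ)).re = ‖x‖ ^ 2 := by
    rw [smul_eq_mul, mul_one]; exact Complex.ofReal_re _
  rw [Complex.sub_re, h1] at h
  linarith

/-- The variance of `x` in the state `σ` is nonnegative, so that `|σ x|² ≤ σ (x* x) ≤ ‖x‖²`. -/
theorem norm_apply_le (σ : State A) (x : A) : ‖σ x‖ ≤ ‖x‖ := by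
  have h0 : 0 ≤ (σ (star (x - σ x • 1) * (x - σ x • 1))).re :=
    (Complex.nonneg_iff.mp (σ.nonneg _)).1
  have h1 : σ (star (x - σ x • 1) * (x - σ x • 1)) = σ (star x * x) - star (σ x) * σ x := by
    simp only [star_sub, star_smul, star_one, sub_mul, mul_sub, mul_smul_comm, smul_mul_assoc,
      one_mul, mul_one, map_sub, map_smul, σ.map_one, σ.map_star, smul_eq_mul]
    ring
  have h2 : (star (σ x) * σ x).re = ‖σ x‖ ^ 2 := by
    rw [Complex.star_def, Complex.conj_mul']
    norm_cast
  rw [h1, Complex.sub_re, h2] at h0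
  have h3 := σ.star_mul_self_le x
  exact (sq_le_sq₀ (norm_nonneg _) (norm_nonneg _)).mp (by linarith)

theorem continuous_coe (σ : State A) : Continuous σ :=
  AddMonoidHomClass.continuous_of_bound σ 1 fun x => by simpa using σ.norm_apply_le x

theorem isEmbedding_coe : IsEmbedding (fun (σ : State A) (x : A) => σ x) :=
  ⟨⟨rfl⟩, DFunLike.coe_injective⟩

theorem continuous_eval (x : A) : Continuous fun σ : State A => σ x :=
  (continuous_apply x).comp isEmbedding_coe.continuous

instance : T2Space (State A) := isEmbedding_coe.t2Space

/-- The state space is closed in the product of the discs of radius `‖x‖`, `x ∈ A`. -/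
instance : CompactSpace (State A) := by
  rw [← isCompact_univ_iff, isEmbedding_coe.isCompact_iff, Set.image_univ]
  refine (isCompact_univ_pi fun x : A => isCompact_closedBall (0 : ℂ) ‖x‖).of_isClosed_subset ?_ ?_
  · have h : Set.range (fun (σ : State A) (x : A) => σ x) =
        {f | (∀ x y, f (x + y) = f x + f y) ∧ (∀ (c : ℂ) x, f (c • x) = c * f x) ∧ f 1 = 1 ∧
          ∀ x, 0 ≤ f (star x * x)} := by
      ext f
      constructor
      · rintro ⟨σ, rfl⟩
        exact ⟨map_add σ, fun c x => map_smul σ c x, σ.map_one, σ.nonneg⟩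
      · rintro ⟨h1, h2, h3, h4⟩
        exact ⟨⟨⟨⟨f, h1⟩, h2⟩, h3, h4⟩, rfl⟩
    rw [h]
    simp only [Set.ofPred_and, Set.ofPred_forall]
    refine .inter ?_ (.inter ?_ (.inter ?_ ?_))
    · exact isClosed_iInter fun x => isClosed_iInter fun y => isClosed_eq (by fun_prop) (by fun_prop)
    · exact isClosed_iInter fun x => isClosed_iInter fun y => isClosed_eq (by fun_prop) (by fun_prop)
    · exact isClosed_eq (by fun_prop) (by fun_prop)
    · exact isClosed_iInter fun x => isClosed_le (by fun_prop) (by fun_prop)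
  · rintro _ ⟨σ, rfl⟩ x -
    simpa using σ.norm_apply_le x

/-- If the correlations `ρ (cᵢ* cⱼ)` of a bounded sequence have a common value `t` for all
`i ≠ j`, then `t ≥ 0`: the off-diagonal terms dominate in `ρ (|c₁ + ⋯ + c_N|²) ≥ 0`. -/
theorem correlation_nonneg (ρ : State A) (c : ℕ → A) (t : ℂ) (M : ℝ) (hM : ∀ i, ‖c i‖ ≤ M)
    (ht : ∀ i j, i ≠ j → ρ (star (c i) * c j) = t) : 0 ≤ t := by
  -- `ρ (|c₁ + ⋯ + c_N|²) = s N + N² t`, where `s N` grows at most linearly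
  let s : ℕ → ℂ := fun N => ∑ i ∈ Finset.range N, (ρ (star (c i) * c i) - t)
  have hs : ∀ N, ‖s N‖ ≤ N * (M * M + ‖t‖) := fun N => by
    refine (norm_sum_le _ _).trans ?_
    refine (Finset.sum_le_card_nsmul _ _ (M * M + ‖t‖) fun i _ => ?_).trans_eq (by simp; ring)
    refine (norm_sub_le _ _).trans (add_le_add_left ?_ _)
    refine (ρ.norm_apply_le _).trans ?_
    rw [CStarRing.norm_star_mul_self]
    exact mul_self_le_mul_self (norm_nonneg _) (hM i)
  have hpos : ∀ N : ℕ, 0 ≤ s N + (N : ℂ) ^ 2 * t := fun N => by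
    have h := ρ.nonneg (∑ i ∈ Finset.range N, c i)
    rw [star_sum, Finset.sum_mul_sum, map_sum] at h
    simp only [map_sum] at h
    refine h.trans_eq ?_
    have h1 : ∀ i ∈ Finset.range N, ∑ j ∈ Finset.range N, ρ (star (c i) * c j) =
        (ρ (star (c i) * c i) - t) + N * t := fun i hi => by
      rw [← Finset.add_sum_erase _ _ hi, Finset.sum_congr rfl (g := fun _ => t) fun j hj =>
        ht i j (Finset.ne_of_mem_erase hj).symm, ← sub_eq_iff_eq_add'.mpr
        (Finset.add_sum_erase (Finset.range N) (fun _ => t) hi).symm]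
      simp
      ring
    rw [Finset.sum_congr rfl h1, Finset.sum_add_distrib]
    simp [s]; ring
  have hlim : Tendsto (fun N : ℕ => s N / (N : ℂ) ^ 2 + t) atTop (𝓝 t) := by
    have h0 : Tendsto (fun N : ℕ => s N / (N : ℂ) ^ 2) atTop (𝓝 0) := by
      refine squeeze_zero_norm (a := fun N : ℕ => (M * M + ‖t‖) / (N : ℝ)) (fun N => ?_)
        (tendsto_const_div_atTop_nhds_zero_nat _)
      rw [norm_div, norm_pow, Complex.norm_natCast]
      rcases N.eq_zero_or_pos with rfl | hN
      · simp
      · have : (0 : ℝ) < N := by exact_mod_cast hN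
        rw [div_le_div_iff₀ (by positivity) this]
        nlinarith [hs N]
    simpa using h0.add_const t
  refine ge_of_tendsto hlim (eventually_atTop.mpr ⟨1, fun N hN => ?_⟩)
  have hN0 : (N : ℂ) ≠ 0 := by exact_mod_cast (by omega : N ≠ 0)
  have h2 : s N / (N : ℂ) ^ 2 + t = (((N : ℝ) ^ 2)⁻¹ : ℝ) * (s N + (N : ℂ) ^ 2 * t) := by
    push_cast; field_simp
  rw [h2]
  exact mul_nonneg (by exact_mod_cast (by positivity)) (hpos N)

end State

variable {D : Type u} [CStarAlgebra D]

/-! ### Single-site embeddings into the infinite tensor power -/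

theorem algTensorMap_siteHom {m n : ℕ} (e : Fin m ↪ Fin n) (i : Fin m) (d : D) :
    algTensorMap e (siteHom i d) = siteHom (e i) d := by
  rw [siteHom_apply, siteHom_apply, algTensorMap_tprod, Pi.mulSingle, Pi.mulSingle,
    extend_update_one]
  congr 2
  exact extend_comp_one (D := D) e (fun _ => 1) rfl 1

theorem commute_siteHom {n : ℕ} {i j : Fin n} (h : i ≠ j) (a b : D) :
    Commute (siteHom i a) (siteHom j b) := by
  rw [siteHom_apply, siteHom_apply]
  exact Commute.tprod (Pi.mulSingle_commute (f := fun _ : Fin n => D) h a b)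

/-- The embedding of `D` as the `i`-th tensor factor of `D^∞`, with places counted from `0`. -/
def site (i : ℕ) : D →⋆ₐ[ℂ] InfMaxTensorPower D :=
  (InfMaxTensorPower.ofPow (i + 1)).comp
    ((maxNorm D (i + 1)).toCompletion.comp (siteHom (Fin.last i)))

theorem ofPow_siteHom {n : ℕ} (i : Fin n) (d : D) :
    InfMaxTensorPower.ofPow n ((maxNorm D n).toCompletion (siteHom i d)) = site (i : ℕ) d := by
  change _ = InfMaxTensorPower.ofPow ((i : ℕ) + 1)
    ((maxNorm D (i + 1)).toCompletion (siteHom (Fin.last i) d))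
  rw [← InfMaxTensorPower.ofPow_incl (i + 1) n i.isLt, MaxTensorPower.incl,
    MaxTensorPower.map_toCompletion, algTensorMap_siteHom]
  rfl

theorem permute_site {n : ℕ} (π : Equiv.Perm (Fin n)) (i : Fin n) (d : D) :
    InfMaxTensorPower.permute π (site (i : ℕ) d) = site (π.symm i : ℕ) d := by
  rw [← ofPow_siteHom i, InfMaxTensorPower.permute, InfMaxTensorPower.ofPow, CStarIndLim.lift_of]
  change InfMaxTensorPower.ofPow (max n n) (MaxTensorPower.map (InfMaxTensorPower.permIndex π n)
    ((maxNorm D n).toCompletion (siteHom i d))) = _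
  rw [MaxTensorPower.map_toCompletion, algTensorMap_siteHom, ofPow_siteHom,
    InfMaxTensorPower.val_permIndex, dif_pos i.isLt]

theorem commute_site {i j : ℕ} (h : i ≠ j) (a b : D) : Commute (site i a) (site j b) := by
  have hi : i < max i j + 1 := by omega
  have hj : j < max i j + 1 := by omega
  have h1 := ofPow_siteHom (⟨i, hi⟩ : Fin (max i j + 1)) a
  have h2 := ofPow_siteHom (⟨j, hj⟩ : Fin (max i j + 1)) b
  rw [← h1, ← h2]
  exact ((commute_siteHom (by simpa using h) a b).map (maxNorm D _).toCompletion).map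
    (InfMaxTensorPower.ofPow _)

/-! ### Products of single-site elements -/

/-- The product of the elements `d` at the places `i`, over the pairs `(i, d)` in the list `l`. -/
def siteProd (l : List (ℕ × D)) : InfMaxTensorPower D := (l.map fun p => site p.1 p.2).prod

@[simp]
theorem siteProd_nil : siteProd ([] : List (ℕ × D)) = 1 := rfl

@[simp]
theorem siteProd_cons (p : ℕ × D) (l : List (ℕ × D)) :
    siteProd (p :: l) = site p.1 p.2 * siteProd l := by simp [siteProd]

theorem siteProd_append (l l' : List (ℕ × D)) :
    siteProd (l ++ l') = siteProd l * siteProd l' := by simp [siteProd]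

theorem star_siteProd (l : List (ℕ × D)) :
    star (siteProd l) = siteProd (l.map (Prod.map id star)).reverse := by
  induction l with
  | nil => simp
  | cons p l ih => simp [siteProd_append, ih, ← map_star]

theorem norm_siteProd_le (l : List (ℕ × D)) :
    ‖siteProd l‖ ≤ (l.map fun p => max 1 ‖p.2‖).prod * ‖(1 : InfMaxTensorPower D)‖ := by
  induction l with
  | nil => simp
  | cons p l ih =>
    rw [siteProd_cons, List.map_cons, List.prod_cons, mul_assoc]
    refine (norm_mul_le _ _).trans (mul_le_mul ?_ ih (norm_nonneg _) (by positivity))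
    exact (NonUnitalStarAlgHom.norm_apply_le (site p.1) p.2).trans (le_max_right _ _)

theorem commute_siteProd {l l' : List (ℕ × D)}
    (h : List.Disjoint (l.map Prod.fst) (l'.map Prod.fst)) :
    Commute (siteProd l) (siteProd l') := by
  refine Commute.list_prod_left _ _ fun x hx => Commute.list_prod_right _ _ fun y hy => ?_
  obtain ⟨p, hp, rfl⟩ := List.mem_map.mp hx
  obtain ⟨q, hq, rfl⟩ := List.mem_map.mp hy
  refine commute_site (fun he => h (List.mem_map_of_mem hp) ?_) _ _
  rw [he]; exact List.mem_map_of_mem hq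

theorem siteProd_perm {l l' : List (ℕ × D)} (h : l.Perm l') (hl : (l.map Prod.fst).Nodup) :
    siteProd l = siteProd l' := by
  induction h with
  | nil => rfl
  | cons p _ ih => rw [siteProd_cons, siteProd_cons, ih (List.nodup_cons.mp hl).2]
  | swap p q l =>
    have hne : q.1 ≠ p.1 := fun he => by simp [he] at hl
    rw [siteProd_cons, siteProd_cons, siteProd_cons, siteProd_cons, ← mul_assoc, ← mul_assoc,
      (commute_site hne q.2 p.2).eq]
  | trans h1 _ ih1 ih2 => rw [ih1 hl, ih2 ((h1.map Prod.fst).nodup_iff.mp hl)]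

theorem permute_siteProd {n : ℕ} (π : Equiv.Perm (Fin n)) (l : List (Fin n × D)) :
    InfMaxTensorPower.permute π (siteProd (l.map fun p => ((p.1 : ℕ), p.2))) =
      siteProd (l.map fun p => ((π.symm p.1 : ℕ), p.2)) := by
  induction l with
  | nil => simp
  | cons p l ih =>
    rw [List.map_cons, siteProd_cons, map_mul, permute_site, ih, List.map_cons, siteProd_cons]

/-! ### Elementary tensors as products of single-site elements -/

/-- The product is over single-site embeddings, which commute; the order is that of the places. -/
theorem tprod_eq_list_prod {n : ℕ} (x : Fin n → D) :
    (PiTensorProduct.tprod ℂ x : AlgTensorPower D n) =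
      (List.ofFn fun i => siteHom i (x i)).prod := by
  have key : ∀ l : List (Fin n), l.Nodup →
      (l.map fun i => (siteHom i (x i) : AlgTensorPower D n)).prod =
        PiTensorProduct.tprod ℂ (fun i => if i ∈ l then x i else 1) := by
    intro l
    induction l with
    | nil => intro; simp [PiTensorProduct.one_def, Pi.one_def]
    | cons a l ih =>
      intro h
      obtain ⟨ha, hl⟩ := List.nodup_cons.mp h
      rw [List.map_cons, List.prod_cons, ih hl, siteHom_apply, PiTensorProduct.tprod_mul_tprod]
      congr 1
      ext j
      by_cases hj : j = a
      · subst hj; simp [ha]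
      · simp [hj]
  have h := key (List.finRange n) (List.nodup_finRange n)
  rw [← List.ofFn_eq_map] at h
  rw [h]
  simp

theorem ofPow_elem {n : ℕ} (x : Fin n → D) :
    InfMaxTensorPower.ofPow n (MaxTensorPower.elem x) =
      siteProd (List.ofFn fun i : Fin n => ((i : ℕ), x i)) := by
  rw [MaxTensorPower.elem, tprod_eq_list_prod, map_list_prod, map_list_prod, List.map_ofFn,
    List.map_ofFn, siteProd, List.map_ofFn]
  congr 2
  ext i
  exact ofPow_siteHom i (x i)

/-- The elementary tensors span a dense subspace of `D^∞`. -/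
theorem mem_of_isClosed {V : Submodule ℂ (InfMaxTensorPower D)}
    (hV : IsClosed (V : Set (InfMaxTensorPower D)))
    (h : ∀ (n : ℕ) (x : Fin n → D), InfMaxTensorPower.ofPow n (MaxTensorPower.elem x) ∈ V)
    (x : InfMaxTensorPower D) : x ∈ V := by
  induction x using CStarIndLim.of_ind with
  | hc => exact hV
  | h n a =>
    change InfMaxTensorPower.ofPow n a ∈ V
    have hc : Continuous (InfMaxTensorPower.ofPow (D := D) n) := map_continuous _
    induction a using (maxNorm D n).denseRange_toCompletion.induction_on with
    | hp => exact hV.preimage hc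
    | ih a =>
      induction a using PiTensorProduct.induction_on with
      | smul_tprod r x =>
        simp only [map_smul]
        exact V.smul_mem r (h n x)
      | add x y hx hy => simp only [map_add]; exact V.add_mem hx hy

/-! ### Moments of a symmetric state -/

/-- The moment of a multiset `{d₁, …, dₙ}` under a state `ρ`: the value of `ρ` at
`d₁ ⊗ ⋯ ⊗ dₙ`, for some enumeration of the multiset. For symmetric `ρ` neither the enumeration
nor the places matter (see `apply_siteProd`). -/
def moment (ρ : State (InfMaxTensorPower D)) (m : Multiset D) : ℂ :=
  ρ (siteProd (m.toList.zipIdx.map Prod.swap))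

section Symmetric

variable {ρ : State (InfMaxTensorPower D)}

theorem apply_siteProd_ofFn (hρ : ρ.IsSymmetric) {k : ℕ} {u v : Fin k → ℕ} (hu : u.Injective) (hv : v.Injective)
    (x : Fin k → D) : ρ (siteProd (List.ofFn fun i => (u i, x i))) =
      ρ (siteProd (List.ofFn fun i => (v i, x i))) := by
  obtain ⟨n, hn⟩ : ∃ n, ∀ i, u i < n ∧ v i < n := by
    refine ⟨∑ i, (u i + v i + 1), fun i => ?_⟩
    have := Finset.single_le_sum (f := fun i => u i + v i + 1) (fun _ _ => Nat.zero_le _)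
      (Finset.mem_univ i)
    omega
  obtain ⟨π, hπ⟩ := Equiv.Perm.exists_extending_pair
    (fun i => (⟨u i, (hn i).1⟩ : Fin n)) (fun i => ⟨v i, (hn i).2⟩)
    (fun i j h => hu (Fin.mk.inj h)) (fun i j h => hv (Fin.mk.inj h))
  have h := permute_siteProd π.symm (List.ofFn fun i => ((⟨u i, (hn i).1⟩ : Fin n), x i))
  simp only [List.map_ofFn, Function.comp_def, Equiv.symm_symm, hπ] at h
  rw [hρ n π.symm, h]

/-- `apply_siteProd_ofFn` for lists of places and elements. -/
theorem apply_siteProd_congr (hρ : ρ.IsSymmetric) {l l' : List (ℕ × D)} (hl : (l.map Prod.fst).Nodup)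
    (hl' : (l'.map Prod.fst).Nodup) (h : l.map Prod.snd = l'.map Prod.snd) :
    ρ (siteProd l) = ρ (siteProd l') := by
  have hlen : l.length = l'.length := by simpa using congrArg List.length h
  have h1 : ∀ l : List (ℕ × D), (l.map Prod.fst).Nodup →
      Function.Injective fun i : Fin l.length => (l.get i).1 := fun l hl i j hij => by
    have := List.nodup_iff_injective_get.mp hl
    have h2 := @this (i.cast (by simp)) (j.cast (by simp)) (by simpa using hij)
    simpa [Fin.ext_iff] using h2
  have h2 := apply_siteProd_ofFn hρ (h1 l hl)
    ((h1 l' hl').comp (Fin.cast_injective hlen)) fun i => (l.get i).2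
  convert h2 using 3
  · exact (List.ofFn_get l).symm
  · refine List.ext_get (by simp [hlen]) fun n h3 h4 => ?_
    have h5 : (l.map Prod.snd)[n]? = (l'.map Prod.snd)[n]? := by rw [h]
    have h6 : n < l.length := by omega
    simp only [List.getElem?_map, List.getElem?_eq_getElem h3, List.getElem?_eq_getElem h6,
      Option.map_some, Option.some.injEq] at h5
    simp [h5]

/-- A symmetric state takes the same value at `d₁ ⊗ ⋯ ⊗ dₙ` whatever (distinct) tensor factors
the `dᵢ` are placed in. -/
theorem apply_siteProd (hρ : ρ.IsSymmetric) {l : List (ℕ × D)} (hl : (l.map Prod.fst).Nodup) :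
    ρ (siteProd l) = moment ρ (l.map Prod.snd) := by
  -- reorder the pairs in `l` so that their elements come in the order chosen by `Multiset.toList`
  have hp : ((l.map Prod.snd : Multiset D).toList).Perm (l.map Prod.snd) :=
    Multiset.coe_eq_coe.mp (Multiset.coe_toList _)
  have hf : List.Forall₂ (fun b (p : ℕ × D) => b = p.2) (l.map Prod.snd) l := by
    rw [List.forall₂_map_left_iff]
    exact List.forall₂_same.mpr fun _ _ => rfl
  obtain ⟨l', h1, h2⟩ := List.perm_comp_forall₂ hp hf
  rw [siteProd_perm h2.symm hl]
  refine apply_siteProd_congr hρ ((h2.map Prod.fst).nodup_iff.mpr hl) ?_ ?_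
  · simp [Function.comp_def, List.nodup_range']
  · have h3 : ∀ {a : List D} {b : List (ℕ × D)}, List.Forall₂ (fun b (p : ℕ × D) => b = p.2) a b →
        b.map Prod.snd = a := by
      intro a b h
      induction h with
      | nil => rfl
      | cons h _ ih => simp [ih, h]
    rw [h3 h1]
    simp [Function.comp_def]

end Symmetric

/-! ### The `*`-algebra of polynomials in the elements of a C*-algebra -/

/-- The monomial `X_{d₁} ⋯ X_{dₙ}`. -/
def word (m : Multiset D) : MvPolynomial D ℂ := (m.map MvPolynomial.X).prod

theorem word_zero : word (0 : Multiset D) = 1 := by simp [word]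

theorem word_add (m m' : Multiset D) : word (m + m') = word m * word m' := by simp [word]

theorem word_singleton (d : D) : word {d} = MvPolynomial.X d := by simp [word]

theorem word_cons (d : D) (m : Multiset D) : word (d ::ₘ m) = MvPolynomial.X d * word m := by
  simp [word]

theorem word_toMultiset (s : D →₀ ℕ) : word s.toMultiset = MvPolynomial.monomial s 1 := by
  rw [MvPolynomial.monomial_eq, map_one, one_mul]
  induction s using Finsupp.induction_linear with
  | zero => simp [word_zero]
  | add f g hf hg =>
    classical
    rw [map_add, word_add, hf, hg, Finsupp.prod_add_index' (by simp) (by simp [pow_add])]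
  | single a n => simp [word, Multiset.map_nsmul, Multiset.prod_nsmul]

@[elab_as_elim]
theorem word_induction {P : MvPolynomial D ℂ → Prop} (p : MvPolynomial D ℂ)
    (hw : ∀ m, P (word m)) (ha : ∀ p q, P p → P q → P (p + q))
    (hc : ∀ (c : ℂ) p, P p → P (c • p)) : P p := by
  induction p using MvPolynomial.induction_on' with
  | monomial s a =>
    have h := hc a _ (hw s.toMultiset)
    rwa [word_toMultiset, MvPolynomial.smul_monomial, smul_eq_mul, mul_one] at h
  | add p q hp hq => exact ha _ _ hp hq

/-- The linear map on polynomials with prescribed values on monomials. -/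
def ofWords {F : Type*} [AddCommGroup F] [Module ℂ F] (g : Multiset D → F) :
    MvPolynomial D ℂ →ₗ[ℂ] F :=
  (MvPolynomial.basisMonomials D ℂ).constr ℂ fun s => g s.toMultiset

@[simp]
theorem ofWords_word {F : Type*} [AddCommGroup F] [Module ℂ F] (g : Multiset D → F)
    (m : Multiset D) : ofWords g (word m) = g m := by
  classical
  have h : m = (Multiset.toFinsupp m).toMultiset := (Multiset.toFinsupp_toMultiset m).symm
  have h1 := (MvPolynomial.basisMonomials D ℂ).constr_basis ℂ (fun s => g s.toMultiset)
    (Multiset.toFinsupp m)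
  rw [MvPolynomial.coe_basisMonomials] at h1
  rwa [h, word_toMultiset]

/-- The antilinear ring homomorphism with `X_d ↦ X_{d*}`. -/
def starPoly : MvPolynomial D ℂ →+* MvPolynomial D ℂ :=
  MvPolynomial.eval₂Hom (MvPolynomial.C.comp (starRingEnd ℂ)) fun d => MvPolynomial.X (star d)

instance : StarRing (MvPolynomial D ℂ) where
  star p := starPoly p
  star_involutive p := by
    change (starPoly.comp starPoly) p = RingHom.id _ p
    congr 1
    ext <;> simp [starPoly]
  star_mul p q := by
    change starPoly (p * q) = starPoly q * starPoly p
    rw [map_mul, mul_comm]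
  star_add := map_add starPoly

theorem star_X (d : D) : star (MvPolynomial.X d : MvPolynomial D ℂ) = MvPolynomial.X (star d) :=
  MvPolynomial.eval₂Hom_X' _ _ _

instance : StarModule ℂ (MvPolynomial D ℂ) where
  star_smul c p := by
    rw [MvPolynomial.smul_eq_C_mul, MvPolynomial.smul_eq_C_mul]
    change starPoly _ = _ * starPoly _
    rw [map_mul]
    congr 1
    exact MvPolynomial.eval₂Hom_C _ _ _

theorem star_word (m : Multiset D) : star (word m) = word (m.map star) := by
  induction m using Multiset.induction_on with
  | empty => simp [word_zero]
  | cons d m ih => rw [word_cons, star_mul, ih, star_X, Multiset.map_cons, word_cons, mul_comm]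

/-! ### The moment functional and its positivity -/

/-- The linear functional `X_{d₁} ⋯ X_{dₙ} ↦ ρ (d₁ ⊗ ⋯ ⊗ dₙ)` on polynomials. -/
def momentFun (ρ : State (InfMaxTensorPower D)) : MvPolynomial D ℂ →ₗ[ℂ] ℂ := ofWords (moment ρ)

@[simp]
theorem momentFun_word (ρ : State (InfMaxTensorPower D)) (m : Multiset D) :
    momentFun ρ (word m) = moment ρ m := ofWords_word _ _

/-- The elements of `m` paired with places in the `j`-th block `{2 + ⟨j, k⟩ | k ∈ ℕ}`, where
`⟨j, k⟩` is the pairing function. The places `0` and `1` are in no block. -/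
def blockList (j : ℕ) (m : Multiset D) : List (ℕ × D) :=
  m.toList.zipIdx.map fun p => (2 + Nat.pair j p.2, p.1)

theorem map_snd_blockList (j : ℕ) (m : Multiset D) : (blockList j m).map Prod.snd = m.toList := by
  simp [blockList, Function.comp_def]

theorem mem_fst_blockList {j : ℕ} {m : Multiset D} {i : ℕ}
    (h : i ∈ (blockList j m).map Prod.fst) : ∃ k, i = 2 + Nat.pair j k := by
  simp only [blockList, List.map_map, List.mem_map, Function.comp_apply] at h
  obtain ⟨p, -, rfl⟩ := h
  exact ⟨_, rfl⟩

theorem nodup_blockList (j : ℕ) (m : Multiset D) : ((blockList j m).map Prod.fst).Nodup := by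
  have h : (blockList j m).map Prod.fst =
      (m.toList.zipIdx.map Prod.snd).map fun k => 2 + Nat.pair j k := by
    simp only [blockList, List.map_map, Function.comp_def]
  rw [h]
  refine List.Nodup.map (fun a b hab => ?_) (by simp [List.nodup_range'])
  exact (Nat.pair_eq_pair.mp (Nat.add_left_cancel hab)).2

theorem disjoint_blockList {i j : ℕ} (h : i ≠ j) (m m' : Multiset D) :
    List.Disjoint ((blockList i m).map Prod.fst) ((blockList j m').map Prod.fst) := by
  intro a h1 h2
  obtain ⟨k, rfl⟩ := mem_fst_blockList h1
  obtain ⟨k', hk⟩ := mem_fst_blockList h2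
  exact h (Nat.pair_eq_pair.mp (Nat.add_left_cancel hk)).1

theorem disjoint_low_blockList {y : List (ℕ × D)} (hy : ∀ a ∈ y.map Prod.fst, a < 2) (j : ℕ)
    (m : Multiset D) : List.Disjoint (y.map Prod.fst) ((blockList j m).map Prod.fst) := by
  intro a h1 h2
  obtain ⟨k, rfl⟩ := mem_fst_blockList h2
  have := hy _ h1
  omega

/-- The linear map that places the factors of a monomial in the `j`-th block of tensor factors
of `D^∞`. -/
def place (j : ℕ) : MvPolynomial D ℂ →ₗ[ℂ] InfMaxTensorPower D :=
  ofWords fun m => siteProd (blockList j m)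

@[simp]
theorem place_word (j : ℕ) (m : Multiset D) : place j (word m) = siteProd (blockList j m) :=
  ofWords_word _ _

theorem exists_norm_place_le (p : MvPolynomial D ℂ) : ∃ M, ∀ j, ‖place j p‖ ≤ M := by
  induction p using word_induction with
  | hw m =>
    refine ⟨(m.toList.map fun d => max 1 ‖d‖).prod * ‖(1 : InfMaxTensorPower D)‖, fun j => ?_⟩
    rw [place_word, ← map_snd_blockList j m, List.map_map]
    exact norm_siteProd_le _
  | ha p q hp hq =>
    obtain ⟨M, hM⟩ := hp
    obtain ⟨M', hM'⟩ := hq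
    exact ⟨M + M', fun j => by
      rw [map_add]; exact (norm_add_le _ _).trans (add_le_add (hM j) (hM' j))⟩
  | hc c p hp =>
    obtain ⟨M, hM⟩ := hp
    exact ⟨‖c‖ * M, fun j => by
      rw [map_smul, norm_smul]; exact mul_le_mul_of_nonneg_left (hM j) (norm_nonneg _)⟩

theorem commute_site_place {i : ℕ} (hi : i < 2) (d : D) (j : ℕ) (p : MvPolynomial D ℂ) :
    Commute (site i d) (place j p) := by
  induction p using word_induction with
  | hw m =>
    have h := commute_siteProd (l := [(i, d)])
      (disjoint_low_blockList (by simpa using hi) j m)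
    rwa [siteProd_cons, siteProd_nil, mul_one, ← place_word] at h
  | ha p q hp hq => rw [map_add]; exact hp.add_right hq
  | hc c p hp => rw [map_smul]; exact hp.smul_right c

section Symmetric

variable {ρ : State (InfMaxTensorPower D)}

/-- Factors in different blocks and at the places `0` and `1` occupy distinct tensor factors, so
that `ρ` evaluates their product by the moment functional. -/
theorem apply_siteProd_mul_place (hρ : ρ.IsSymmetric) {y : List (ℕ × D)} (hy : (y.map Prod.fst).Nodup)
    (hy2 : ∀ a ∈ y.map Prod.fst, a < 2) {i j : ℕ} (hij : i ≠ j) (p q : MvPolynomial D ℂ) :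
    ρ (siteProd y * (star (place i p) * place j q)) =
      momentFun ρ (word (y.map Prod.snd) * (star p * q)) := by
  induction p using word_induction with
  | ha p p' hp hp' => simp only [map_add, star_add, add_mul, mul_add, hp, hp']
  | hc c p hp => simp only [map_smul, star_smul, smul_mul_assoc, mul_smul_comm, hp]
  | hw m =>
    induction q using word_induction with
    | ha p p' hp hp' => simp only [map_add, mul_add, hp, hp']
    | hc c p hp => simp only [map_smul, mul_smul_comm, hp]
    | hw m' =>
      have hfst : ((blockList i m).map (Prod.map id star)).reverse.map Prod.fst =
          ((blockList i m).map Prod.fst).reverse := by simp [List.map_reverse]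
      rw [place_word, place_word, star_siteProd, ← siteProd_append, ← siteProd_append,
        apply_siteProd hρ, star_word, ← word_add, ← word_add, momentFun_word]
      · congr 1
        simp only [List.map_append, List.map_reverse, List.map_map, ← Multiset.coe_add,
          Multiset.coe_reverse, map_snd_blockList, Multiset.coe_toList]
        congr 2
        have hm : m.map star = (m.toList.map star : List D) := by
          rw [← Multiset.map_coe, Multiset.coe_toList]
        rw [hm, ← map_snd_blockList i m, List.map_map]
        rfl
      · rw [List.map_append, List.map_append, List.nodup_append', List.nodup_append', hfst]
        refine ⟨hy, ⟨List.nodup_reverse.mpr (nodup_blockList i m), nodup_blockList j m', ?_⟩, ?_⟩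
        · intro a h1 h2
          exact disjoint_blockList hij m m' (List.mem_reverse.mp h1) h2
        · intro a h1 h2
          rcases List.mem_append.mp h2 with h2 | h2
          · exact disjoint_low_blockList hy2 i m h1 (List.mem_reverse.mp h2)
          · exact disjoint_low_blockList hy2 j m' h1 h2

/-- The positivity mechanism: copies of `p` placed in different blocks, multiplied by a fixed
element `Y` supported away from the blocks, have constant off-diagonal correlations. -/
theorem momentFun_nonneg_of (w p : MvPolynomial D ℂ) (Y : InfMaxTensorPower D)
    (hY : ∀ j, Commute Y (place j p)) (hY' : ∀ j, Commute (star Y) (place j p))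
    (hw : ∀ i j, i ≠ j → ρ (star Y * Y * (star (place i p) * place j p)) =
      momentFun ρ (w * (star p * p))) : 0 ≤ momentFun ρ (w * (star p * p)) := by
  obtain ⟨M, hM⟩ := exists_norm_place_le p
  refine ρ.correlation_nonneg (fun j => Y * place j p) _ (‖Y‖ * M) (fun j =>
    (norm_mul_le _ _).trans (mul_le_mul_of_nonneg_left (hM j) (norm_nonneg _))) fun i j hij => ?_
  rw [← hw i j hij]
  congr 1
  have h : Commute (star Y * Y) (star (place i p)) := by
    have h1 : Commute Y (star (place i p)) := by simpa using (hY' i).star_star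
    exact (hY i).star_star.mul_left h1
  rw [star_mul, mul_assoc, ← mul_assoc (star Y), ← mul_assoc, ← h.eq, ← mul_assoc]

theorem momentFun_nonneg (hρ : ρ.IsSymmetric) (p : MvPolynomial D ℂ) :
    0 ≤ momentFun ρ (star p * p) := by
  have h := momentFun_nonneg_of (ρ := ρ) 1 p 1 (fun _ => Commute.one_left _)
    (fun _ => by rw [star_one]; exact Commute.one_left _) fun i j hij => by
      have h := apply_siteProd_mul_place hρ (y := []) (by simp) (by simp) hij p p
      simpa [word_zero] using h
  rwa [one_mul] at h

/-- A positive element of `D` in an additional tensor factor preserves positivity. -/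
theorem momentFun_X_nonneg (hρ : ρ.IsSymmetric) (d : D) (p : MvPolynomial D ℂ) :
    0 ≤ momentFun ρ (MvPolynomial.X (star d * d) * (star p * p)) := by
  refine momentFun_nonneg_of _ p (site 0 d) (fun _ => commute_site_place two_pos _ _ _)
    (fun _ => by rw [← map_star]; exact commute_site_place two_pos _ _ _) fun i j hij => ?_
  have h := apply_siteProd_mul_place hρ (y := [(0, star d * d)]) (by simp) (by simp) hij p p
  rw [← map_star]
  simpa [word_singleton] using h

/-- The form `d ↦ X_{d*d} - X_{d*} X_d` is positive, being half of `|d ⊗ 1 - 1 ⊗ d|²`. -/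
theorem momentFun_variance_nonneg (hρ : ρ.IsSymmetric) (d : D) (p : MvPolynomial D ℂ) :
    0 ≤ momentFun ρ ((MvPolynomial.X (star d * d) -
      MvPolynomial.X (star d) * MvPolynomial.X d) * (star p * p)) := by
  have hY : ∀ (d : D) j, Commute (site 0 d - site 1 d) (place j p) := fun d j =>
    (commute_site_place two_pos _ _ _).sub_left (commute_site_place one_lt_two _ _ _)
  have h := momentFun_nonneg_of (ρ := ρ) ((2 : ℂ) • (MvPolynomial.X (star d * d) -
      MvPolynomial.X (star d) * MvPolynomial.X d)) p (site 0 d - site 1 d) (hY d)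
    (fun j => by rw [star_sub, ← map_star, ← map_star]; exact hY _ j) fun i j hij => by
      have h1 := apply_siteProd_mul_place hρ (y := [(0, star d * d)]) (by simp) (by simp) hij p p
      have h2 := apply_siteProd_mul_place hρ (y := [(1, star d * d)]) (by simp) (by simp) hij p p
      have h3 := apply_siteProd_mul_place hρ (y := [(0, star d), (1, d)]) (by simp) (by simp)
        hij p p
      have h4 := apply_siteProd_mul_place hρ (y := [(1, star d), (0, d)]) (by simp) (by simp)
        hij p p
      simp only [siteProd_cons, siteProd_nil, mul_one, List.map_cons, List.map_nil,
        ← Multiset.cons_coe, Multiset.coe_nil, word_cons, word_zero] at h1 h2 h3 h4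
      rw [star_sub, sub_mul, mul_sub, mul_sub, ← map_star, ← map_star, ← map_mul, ← map_mul]
      simp only [sub_mul, map_sub, h1, h2, h3, h4, two_smul, add_mul, map_add]
      ring
  rw [smul_mul_assoc, map_smul, smul_eq_mul] at h
  have h2 : (0 : ℂ) ≤ 2⁻¹ := by positivity
  simpa using mul_nonneg h2 h

theorem momentFun_X_mul_word (hρ : ρ.IsSymmetric) (d : D) (m : Multiset D) :
    momentFun ρ (MvPolynomial.X d * word m) = ρ (site 0 d * siteProd (blockList 0 m)) := by
  rw [← siteProd_cons (0, d), apply_siteProd hρ, ← word_cons, momentFun_word, List.map_cons,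
    ← Multiset.cons_coe, map_snd_blockList, Multiset.coe_toList]
  rw [List.map_cons, List.nodup_cons]
  refine ⟨fun h => ?_, nodup_blockList 0 m⟩
  obtain ⟨k, hk⟩ := mem_fst_blockList h
  simp at hk
  omega

theorem momentFun_X_add (hρ : ρ.IsSymmetric) (a b : D) (q : MvPolynomial D ℂ) :
    momentFun ρ (MvPolynomial.X (a + b) * q) =
      momentFun ρ (MvPolynomial.X a * q) + momentFun ρ (MvPolynomial.X b * q) := by
  induction q using word_induction with
  | hw m => simp only [momentFun_X_mul_word hρ, map_add, add_mul]
  | ha p q hp hq => simp only [mul_add, map_add, hp, hq]; ring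
  | hc c p hp => simp only [mul_smul_comm, map_smul, hp, smul_add]

theorem momentFun_X_smul (hρ : ρ.IsSymmetric) (c : ℂ) (a : D) (q : MvPolynomial D ℂ) :
    momentFun ρ (MvPolynomial.X (c • a) * q) = c * momentFun ρ (MvPolynomial.X a * q) := by
  induction q using word_induction with
  | hw m => simp only [momentFun_X_mul_word hρ, map_smul, smul_mul_assoc, smul_eq_mul]
  | ha p q hp hq => simp only [mul_add, map_add, hp, hq]
  | hc c' p hp => simp only [mul_smul_comm, map_smul, hp, smul_eq_mul]; ring

theorem momentFun_X_one (hρ : ρ.IsSymmetric) (q : MvPolynomial D ℂ) :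
    momentFun ρ (MvPolynomial.X 1 * q) = momentFun ρ q := by
  induction q using word_induction with
  | hw m =>
    rw [momentFun_X_mul_word hρ, map_one, one_mul, apply_siteProd hρ (nodup_blockList 0 m),
      map_snd_blockList, Multiset.coe_toList, momentFun_word]
  | ha p q hp hq => simp only [mul_add, map_add, hp, hq]
  | hc c' p hp => simp only [mul_smul_comm, map_smul, hp]

theorem apply_elem (hρ : ρ.IsSymmetric) {n : ℕ} (x : Fin n → D) :
    ρ (InfMaxTensorPower.ofPow n (MaxTensorPower.elem x)) =
      momentFun ρ (∏ i, MvPolynomial.X (x i)) := by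
  rw [ofPow_elem, apply_siteProd hρ, ← momentFun_word, word, Multiset.map_coe, List.map_map,
    List.map_ofFn, Multiset.prod_coe, List.prod_ofFn]
  · rfl
  · rw [List.map_ofFn]
    exact List.nodup_ofFn.mpr Fin.val_injective

/-! ### The Hilbert space of the moment functional -/

/-- The moment functional as a positive functional. -/
def momentPos (hρ : ρ.IsSymmetric) : PosFunctional (MvPolynomial D ℂ) :=
  ⟨momentFun ρ, momentFun_nonneg hρ⟩

/-- The operator inequality `X_{d*d} ≤ ‖d‖²`, from positivity of `X_{e*e}` for
`e* e = ‖d‖² - d* d`. -/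
theorem momentFun_X_mul_le (hρ : ρ.IsSymmetric) (d : D) (p : MvPolynomial D ℂ) :
    (momentFun ρ (MvPolynomial.X (star d * d) * (star p * p))).re ≤
      ‖d‖ ^ 2 * (momentFun ρ (star p * p)).re := by
  let _ := CStarAlgebra.spectralOrder D
  let _ := CStarAlgebra.spectralOrderedRing D
  obtain ⟨e, he⟩ := CStarAlgebra.nonneg_iff_eq_star_mul_self.mp
    (sub_nonneg.mpr (CStarAlgebra.star_mul_le_algebraMap_norm_sq (a := d)))
  have h := (Complex.nonneg_iff.mp (momentFun_X_nonneg hρ e p)).1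
  have h1 : star e * e + star d * d = ((‖d‖ ^ 2 : ℝ) : ℂ) • (1 : D) := by
    rw [← he, IsScalarTower.algebraMap_apply ℝ ℂ D, Algebra.algebraMap_eq_smul_one,
      sub_add_cancel]
    rfl
  have h2 := momentFun_X_add hρ (star e * e) (star d * d) (star p * p)
  rw [h1, momentFun_X_smul hρ, momentFun_X_one hρ] at h2
  have h3 := congrArg Complex.re h2
  rw [Complex.re_ofReal_mul, Complex.add_re] at h3
  linarith

/-- Multiplication by a polynomial is bounded for the moment functional, with
`‖X_d p‖ ≤ ‖d‖ ‖p‖`. -/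
theorem momentPos_bdd (hρ : ρ.IsSymmetric) (a : MvPolynomial D ℂ) :
    ∃ C : ℝ, ∀ x : MvPolynomial D ℂ,
      ‖(momentPos hρ).toPre (a * x)‖ ≤ C * ‖(momentPos hρ).toPre x‖ := by
  suffices h : ∃ C : ℝ, 0 ≤ C ∧ ∀ x : MvPolynomial D ℂ,
      ‖(momentPos hρ).toPre (a * x)‖ ≤ C * ‖(momentPos hρ).toPre x‖ from h.imp fun _ h => h.2
  induction a using MvPolynomial.induction_on with
  | C c =>
    refine ⟨‖c‖, norm_nonneg _, fun x => ?_⟩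
    rw [← MvPolynomial.smul_eq_C_mul, map_smul, norm_smul]
  | add a b ha hb =>
    obtain ⟨C, h0, hC⟩ := ha
    obtain ⟨C', h0', hC'⟩ := hb
    refine ⟨C + C', add_nonneg h0 h0', fun x => ?_⟩
    rw [add_mul, add_mul, map_add]
    exact (norm_add_le _ _).trans (add_le_add (hC x) (hC' x))
  | mul_X a d ha =>
    obtain ⟨C, h0, hC⟩ := ha
    refine ⟨C * ‖d‖, mul_nonneg h0 (norm_nonneg _), fun x => ?_⟩
    rw [mul_assoc, mul_assoc]
    refine (hC _).trans (mul_le_mul_of_nonneg_left ?_ h0)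
    refine (sq_le_sq₀ (norm_nonneg _) (by positivity)).mp ?_
    rw [mul_pow, PosFunctional.normSq_def, PosFunctional.normSq_def]
    -- `X_{d*} X_d ≤ X_{d*d} ≤ ‖d‖²`
    have h1 := (Complex.nonneg_iff.mp (momentFun_variance_nonneg hρ d x)).1
    have h2 := momentFun_X_mul_le hρ d x
    rw [sub_mul, map_sub, Complex.sub_re] at h1
    have h3 : star (MvPolynomial.X d * x) * (MvPolynomial.X d * x) =
        MvPolynomial.X (star d) * MvPolynomial.X d * (star x * x) := by
      rw [star_mul, star_X]; ring
    change (momentFun ρ _).re ≤ _ * (momentFun ρ _).re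
    rw [h3]
    linarith

end Symmetric

/-! ### Characters as states -/

/-- The evaluation `σ ↦ σ d` as a continuous function on the state space. -/
def evalMap (d : D) : C(State D, ℂ) := ⟨fun σ => σ d, State.continuous_eval d⟩

section Gelfand

variable {B : Type u} [CStarAlgebra B] [PartialOrder B] [StarOrderedRing B]

/-- A representation of the polynomial `*`-algebra in which `X_d` is linear, unital and positive in
`d` factors through the continuous functions on the state space: every character `χ` of the
commutative C*-algebra generated by the `X_d` restricts to a state `d ↦ χ (X_d)`. -/
theorem exists_starAlgHom_of_positive (π : MvPolynomial D ℂ →⋆ₐ[ℂ] B)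
    (hadd : ∀ a b : D, π (MvPolynomial.X (a + b)) = π (MvPolynomial.X a) + π (MvPolynomial.X b))
    (hsmul : ∀ (c : ℂ) (a : D), π (MvPolynomial.X (c • a)) = c • π (MvPolynomial.X a))
    (hone : π (MvPolynomial.X 1) = 1)
    (hpos : ∀ a : D, 0 ≤ π (MvPolynomial.X (star a * a))) :
    ∃ Φ : C(State D, ℂ) →⋆ₐ[ℂ] B, ∀ d, Φ (evalMap d) = π (MvPolynomial.X d) := by
  let S : StarSubalgebra ℂ B := π.range.topologicalClosure
  have hS : IsClosed (S : Set B) := StarSubalgebra.isClosed_topologicalClosure _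
  let _ : CommRing S := π.range.commRingTopologicalClosure (by
    rintro ⟨_, x, rfl⟩ ⟨_, y, rfl⟩
    refine Subtype.ext ?_
    change π x * π y = π y * π x
    rw [← map_mul, ← map_mul, mul_comm])
  let _ : CompleteSpace S := hS.completeSpace_coe
  let _ : CStarAlgebra S := {}
  let _ : CommCStarAlgebra S := { mul_comm := mul_comm }
  let z : D → S := fun d =>
    ⟨π (MvPolynomial.X d), StarSubalgebra.le_topologicalClosure _ ⟨_, rfl⟩⟩
  have zadd : ∀ a b, z (a + b) = z a + z b := fun a b => Subtype.ext (hadd a b)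
  have zsmul : ∀ (c : ℂ) a, z (c • a) = c • z a := fun c a => Subtype.ext (hsmul c a)
  have zone : z 1 = 1 := Subtype.ext hone
  let τ : C(WeakDual.characterSpace ℂ S, State D) :=
    { toFun := fun χ =>
        { toLinearMap :=
            { toFun := fun d => χ (z d)
              map_add' := fun a b => by rw [zadd, map_add]
              map_smul' := fun c a => by rw [zsmul, map_smul]; rfl }
          map_one' := by
            change χ (z 1) = 1
            rw [zone, map_one]
          nonneg' := fun a => by
            change 0 ≤ χ (z (star a * a))
            -- a value of a character lies in the spectrum, which is the same in `S` and in `B`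
            have h1 : χ (z (star a * a)) ∈ spectrum ℂ (z (star a * a)) :=
              AlgHom.apply_mem_spectrum χ _
            have h2 := (S.mem_spectrum_iff (hS := hS)).mp h1
            have hsa : IsSelfAdjoint (z (star a * a) : B) := IsSelfAdjoint.of_nonneg (hpos a)
            have h3 : χ (z (star a * a)) = ((χ (z (star a * a))).re : ℂ) :=
              hsa.mem_spectrum_eq_re h2
            rw [h3] at h2
            rw [h3]
            exact Complex.zero_le_real.mpr
              (spectrum_nonneg_of_nonneg (hpos a) (hsa.coe_mem_spectrum_complex.mp h2)) }
      continuous_toFun := by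
        refine State.isEmbedding_coe.isInducing.continuous_iff.mpr (continuous_pi fun d => ?_)
        exact (map_continuous (WeakDual.gelfandTransform ℂ S (z d))) }
  refine ⟨S.subtype.comp (((gelfandStarTransform S).symm : _ →⋆ₐ[ℂ] S).comp
    (ContinuousMap.compStarAlgHom' ℂ ℂ τ)), fun d => ?_⟩
  have h : ContinuousMap.compStarAlgHom' ℂ ℂ τ (evalMap d) = gelfandStarTransform S (z d) := by
    ext χ
    rfl
  change (((gelfandStarTransform S).symm (ContinuousMap.compStarAlgHom' ℂ ℂ τ (evalMap d)) : S) : B)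
    = _
  rw [h, StarAlgEquiv.symm_apply_apply]

end Gelfand

/-! ### The functional on the continuous functions of the state space -/

section Symmetric

variable {ρ : State (InfMaxTensorPower D)}

/-- Polynomials that the moment functional cannot distinguish after multiplication by any
polynomial act equally in its GNS representation. -/
theorem gns_eq_of_momentFun_eq (hρ : ρ.IsSymmetric) {a b : MvPolynomial D ℂ}
    (h : ∀ q, momentFun ρ (a * q) = momentFun ρ (b * q)) :
    (momentPos hρ).gns (momentPos_bdd hρ) a = (momentPos hρ).gns (momentPos_bdd hρ) b := by
  refine (momentPos hρ).gns_ext fun x => ?_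
  change (momentPos hρ).gnsOp _ a _ = (momentPos hρ).gnsOp _ b _
  rw [PosFunctional.gnsOp_coe, PosFunctional.gnsOp_coe, ← sub_eq_zero,
    ← UniformSpace.Completion.coe_sub, ← norm_eq_zero, UniformSpace.Completion.norm_coe, ← map_sub,
    ← sq_eq_zero_iff, PosFunctional.normSq_def]
  change (momentFun ρ _).re = 0
  have h1 : star (a * x - b * x) * (a * x - b * x) =
      a * (star (a * x - b * x) * x) - b * (star (a * x - b * x) * x) := by ring
  rw [h1, map_sub, h, sub_self, Complex.zero_re]

theorem inner_gns_coe {A : Type u} [Ring A] [StarRing A] [Algebra ℂ A] [StarModule ℂ A]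
    (φ : PosFunctional A) (hb : ∀ a : A, ∃ C : ℝ, ∀ x : A, ‖φ.toPre (a * x)‖ ≤ C * ‖φ.toPre x‖)
    (a x y : A) : inner ℂ (φ.gns hb a (φ.toPre x : φ.GNS)) (φ.toPre y : φ.GNS) =
      φ.toLinearMap (star (a * x) * y) := by
  change inner ℂ (φ.gnsOp hb a (φ.toPre x : φ.GNS)) (φ.toPre y : φ.GNS) = _
  rw [PosFunctional.gnsOp_coe, UniformSpace.Completion.inner_coe, PosFunctional.inner_def]
  rfl

theorem gns_X_nonneg (hρ : ρ.IsSymmetric) (a : D) :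
    0 ≤ (momentPos hρ).gns (momentPos_bdd hρ) (MvPolynomial.X (star a * a)) := by
  rw [ContinuousLinearMap.nonneg_iff_isPositive, ContinuousLinearMap.isPositive_iff_complex]
  suffices h : ∀ y, 0 ≤ inner ℂ ((momentPos hρ).gns (momentPos_bdd hρ)
      (MvPolynomial.X (star a * a)) y) y from fun y =>
    ⟨Complex.ext rfl (Complex.nonneg_iff.mp (h y)).2, (Complex.nonneg_iff.mp (h y)).1⟩
  intro y
  induction y using UniformSpace.Completion.induction_on with
  | hp => exact isClosed_le continuous_const (by fun_prop)
  | ih y =>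
    obtain ⟨p, rfl⟩ := (momentPos hρ).toPre.surjective y
    refine le_of_le_of_eq ?_ (inner_gns_coe _ _ _ p p).symm
    refine (momentFun_X_nonneg hρ a p).trans_eq ?_
    change _ = momentFun ρ (star (MvPolynomial.X (star a * a) * p) * p)
    rw [star_mul, star_X, star_mul, star_star]
    congr 1
    ring

/-- A symmetric state is a vector functional in a representation of the continuous functions on
the state space. -/
theorem exists_representation (hρ : ρ.IsSymmetric) :
    ∃ (H : Type u) (_ : NormedAddCommGroup H) (_ : InnerProductSpace ℂ H) (_ : CompleteSpace H)
      (Φ : C(State D, ℂ) →⋆ₐ[ℂ] (H →L[ℂ] H)) (Ω : H), ∀ (n : ℕ) (x : Fin n → D),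
        inner ℂ Ω (Φ (∏ i, evalMap (x i)) Ω) =
          ρ (InfMaxTensorPower.ofPow n (MaxTensorPower.elem x)) := by
  obtain ⟨Φ, hΦ⟩ := exists_starAlgHom_of_positive ((momentPos hρ).gns (momentPos_bdd hρ))
    (fun a b => by
      rw [← map_add]
      exact gns_eq_of_momentFun_eq hρ fun q => by rw [momentFun_X_add hρ, add_mul, map_add])
    (fun c a => by
      rw [← map_smul]
      exact gns_eq_of_momentFun_eq hρ fun q => by
        rw [momentFun_X_smul hρ, smul_mul_assoc, map_smul, smul_eq_mul])
    (by
      rw [← map_one ((momentPos hρ).gns (momentPos_bdd hρ))]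
      exact gns_eq_of_momentFun_eq hρ fun q => by rw [momentFun_X_one hρ, one_mul])
    (gns_X_nonneg hρ)
  refine ⟨(momentPos hρ).GNS, inferInstance, inferInstance, inferInstance, Φ,
    ((momentPos hρ).toPre 1 : (momentPos hρ).GNS), fun n x => ?_⟩
  have hin := (momentPos hρ).inner_gns (momentPos_bdd hρ) (∏ i, MvPolynomial.X (x i))
  refine Eq.trans ?_ (hin.trans (apply_elem hρ x).symm)
  have h : Φ (∏ i, evalMap (x i)) =
      (momentPos hρ).gns (momentPos_bdd hρ) (∏ i, MvPolynomial.X (x i)) := by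
    rw [← List.prod_ofFn, ← List.prod_ofFn, map_list_prod, map_list_prod, List.map_ofFn,
      List.map_ofFn]
    simp only [Function.comp_def, hΦ]
  rw [h]

/-- The vacuum functional of `exists_representation`. -/
theorem exists_functional (hρ : ρ.IsSymmetric) :
    ∃ φ : C(State D, ℂ) →ₗ[ℂ] ℂ, (∀ f, 0 ≤ φ (star f * f)) ∧
      ∀ (n : ℕ) (x : Fin n → D), φ (∏ i, evalMap (x i)) =
        ρ (InfMaxTensorPower.ofPow n (MaxTensorPower.elem x)) := by
  obtain ⟨H, _, _, _, Φ, Ω, h⟩ := exists_representation hρ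
  refine ⟨(innerSL ℂ Ω).toLinearMap ∘ₗ (ContinuousLinearMap.apply ℂ _ Ω).toLinearMap ∘ₗ
    Φ.toAlgHom.toLinearMap, fun f => ?_, h⟩
  change 0 ≤ inner ℂ Ω (Φ (star f * f) Ω)
  rw [map_mul, map_star]
  change 0 ≤ inner ℂ Ω (ContinuousLinearMap.adjoint (Φ f) (Φ f Ω))
  rw [ContinuousLinearMap.adjoint_inner_right, inner_self_eq_norm_sq_to_K]
  refine (Complex.zero_le_real.mpr (sq_nonneg ‖Φ f Ω‖)).trans_eq ?_
  push_cast
  rfl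

end Symmetric

/-! ### Representing measures -/

section Riesz

variable {K : Type*} [TopologicalSpace K]

/-- A real continuous function as a complex one. -/
def ofRealMap (g : C(K, ℝ)) : C(K, ℂ) := ⟨fun x => (g x : ℂ), by fun_prop⟩

theorem re_map_ofRealMap_nonneg (φ : C(K, ℂ) →ₗ[ℂ] ℂ) (hφ : ∀ f, 0 ≤ φ (star f * f))
    (g : C(K, ℝ)) (hg : ∀ x, 0 ≤ g x) : 0 ≤ (φ (ofRealMap g)).re := by
  have h : ofRealMap g = star (ofRealMap ⟨fun x => √(g x), by fun_prop⟩) *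
      ofRealMap ⟨fun x => √(g x), by fun_prop⟩ := by
    ext x
    change (g x : ℂ) = (starRingEnd ℂ) (√(g x) : ℂ) * (√(g x) : ℂ)
    rw [Complex.conj_ofReal, ← Complex.ofReal_mul, Real.mul_self_sqrt (hg x)]
  rw [h]
  exact (Complex.nonneg_iff.mp (hφ _)).1

theorem map_ofRealMap_im (φ : C(K, ℂ) →ₗ[ℂ] ℂ) (hφ : ∀ f, 0 ≤ φ (star f * f)) (g : C(K, ℝ)) :
    (φ (ofRealMap g)).im = 0 := by
  have h : star (ofRealMap g) = ofRealMap g := by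
    ext x
    exact Complex.conj_ofReal _
  have h1 := map_star_of_pos φ hφ (ofRealMap g)
  rw [h] at h1
  exact Complex.conj_eq_iff_im.mp h1.symm

variable [CompactSpace K] [T2Space K] [MeasurableSpace K] [BorelSpace K]

theorem integrable_continuousMap (μ : Measure K) [IsFiniteMeasure μ] (f : C(K, ℂ)) :
    Integrable f μ :=
  f.continuous.integrable_of_hasCompactSupport (HasCompactSupport.of_compactSpace f)

/-- Every positive linear functional on `C(K, ℂ)`, for `K` compact, is integration against a
finite regular Borel measure. -/
theorem exists_measure_of_positive (φ : C(K, ℂ) →ₗ[ℂ] ℂ) (hφ : ∀ f, 0 ≤ φ (star f * f)) :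
    ∃ μ : Measure K, IsFiniteMeasure μ ∧ μ.Regular ∧ ∀ f, φ f = ∫ x, f x ∂μ := by
  let L : CompactlySupportedContinuousMap K ℝ →ₗ[ℝ] ℝ :=
    { toFun := fun g => (φ (ofRealMap g)).re
      map_add' := fun g h => by
        rw [← Complex.add_re, ← map_add]
        congr 2
        ext x
        simp [ofRealMap]
      map_smul' := fun c g => by
        have h : ofRealMap (c • g : CompactlySupportedContinuousMap K ℝ).toContinuousMap =
            (c : ℂ) • ofRealMap g.toContinuousMap := by
          ext x
          simp [ofRealMap]
        change (φ (ofRealMap (c • g : CompactlySupportedContinuousMap K ℝ).toContinuousMap)).re = _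
        rw [h, map_smul, smul_eq_mul, Complex.re_ofReal_mul]
        rfl }
  let Λ : CompactlySupportedContinuousMap K ℝ →ₚ[ℝ] ℝ :=
    PositiveLinearMap.mk₀ L fun g hg => re_map_ofRealMap_nonneg φ hφ g hg
  have hreal : ∀ g : C(K, ℝ), φ (ofRealMap g) = ∫ x, ofRealMap g x ∂(RealRMK.rieszMeasure Λ) :=
    fun g => by
      have h := RealRMK.integral_rieszMeasure Λ ⟨g, HasCompactSupport.of_compactSpace g⟩
      change ∫ x, g x ∂_ = (φ (ofRealMap g)).re at h
      change _ = ∫ x, (g x : ℂ) ∂(RealRMK.rieszMeasure Λ)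
      rw [integral_complex_ofReal, h]
      exact Complex.ext rfl (map_ofRealMap_im φ hφ g)
  refine ⟨RealRMK.rieszMeasure Λ, inferInstance, inferInstance, fun f => ?_⟩
  let a : C(K, ℝ) := ⟨fun x => (f x).re, by fun_prop⟩
  let b : C(K, ℝ) := ⟨fun x => (f x).im, by fun_prop⟩
  have hf : f = ofRealMap a + Complex.I • ofRealMap b := by
    ext x
    change f x = ((f x).re : ℂ) + Complex.I * ((f x).im : ℂ)
    rw [mul_comm, Complex.re_add_im]
  rw [hf, map_add, map_smul, hreal, hreal, smul_eq_mul, ← integral_const_mul, ← integral_add]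
  · rfl
  · exact integrable_continuousMap _ _
  · exact (integrable_continuousMap _ _).const_mul _

theorem measure_ext_of_integral_eq (μ ν : Measure K) [μ.Regular] [ν.Regular]
    (h : ∀ f : C(K, ℂ), ∫ x, f x ∂μ = ∫ x, f x ∂ν) : μ = ν := by
  refine Measure.ext_of_integral_eq_on_compactlySupported fun f => ?_
  have h1 := h (ofRealMap f)
  change ∫ x, ((f x : ℝ) : ℂ) ∂μ = ∫ x, ((f x : ℝ) : ℂ) ∂ν at h1
  rw [integral_complex_ofReal, integral_complex_ofReal] at h1
  exact_mod_cast h1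

/-- Integration as a continuous linear functional on the continuous functions. -/
def integralMap (μ : Measure K) [IsFiniteMeasure μ] : C(K, ℂ) →L[ℂ] ℂ :=
  LinearMap.mkContinuous
    { toFun := fun f => ∫ x, f x ∂μ
      map_add' := fun f g =>
        integral_add (integrable_continuousMap μ f) (integrable_continuousMap μ g)
      map_smul' := fun c f => integral_const_mul c _ } (μ.real Set.univ) fun f => by
    rw [mul_comm]
    exact norm_integral_le_of_norm_le_const (.of_forall fun x => f.norm_coe_le_norm x)

theorem integralMap_apply (μ : Measure K) [IsFiniteMeasure μ] (f : C(K, ℂ)) :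
    integralMap μ f = ∫ x, f x ∂μ := rfl

end Riesz

/-! ### Continuous functions on the state space -/

theorem star_evalMap (d : D) : star (evalMap d) = evalMap (star d) := by
  ext σ
  exact (σ.map_star d).symm

/-- The products of evaluations span a dense subspace of the continuous functions on the state
space. -/
theorem mem_of_prod_evalMap_mem {V : Submodule ℂ C(State D, ℂ)}
    (hV : IsClosed (V : Set C(State D, ℂ)))
    (h : ∀ (n : ℕ) (x : Fin n → D), ∏ i, evalMap (x i) ∈ V) (f : C(State D, ℂ)) : f ∈ V := by
  have hstar : star (Set.range (evalMap (D := D))) = Set.range evalMap := by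
    ext g
    constructor
    · rintro ⟨d, hd⟩
      exact ⟨star d, by rw [← star_evalMap, hd, star_star]⟩
    · rintro ⟨d, rfl⟩
      exact ⟨star d, (star_evalMap d).symm⟩
  let S := StarAlgebra.adjoin ℂ (Set.range (evalMap (D := D)))
  have hdense : S.topologicalClosure = ⊤ := by
    refine ContinuousMap.starSubalgebra_topologicalClosure_eq_top_of_separatesPoints _ ?_
    intro σ τ hne
    obtain ⟨d, hd⟩ := DFunLike.ne_iff.mp hne
    exact ⟨_, ⟨evalMap d, StarAlgebra.subset_adjoin ℂ _ ⟨d, rfl⟩, rfl⟩, hd⟩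
  have hSV : (S : Set C(State D, ℂ)) ⊆ V := by
    intro g hg
    have hg1 : g ∈ Algebra.adjoin ℂ (Set.range (evalMap (D := D))) := by
      have h1 : g ∈ S.toSubalgebra := hg
      rwa [StarAlgebra.adjoin_toSubalgebra, hstar, Set.union_self] at h1
    rw [← Subalgebra.mem_toSubmodule, Algebra.adjoin_eq_span] at hg1
    refine Submodule.span_le.mpr ?_ hg1
    intro p hp
    obtain ⟨l, hl, rfl⟩ := Submonoid.exists_list_of_mem_closure hp
    choose! d hd using hl
    have h2 : l = List.ofFn fun i : Fin l.length => evalMap (d (l.get i)) := by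
      conv_lhs => rw [← List.ofFn_get l]
      congr 1
      ext1 i
      exact (hd _ (l.get_mem i)).symm
    rw [h2, List.prod_ofFn]
    exact h _ _
  have h3 : f ∈ S.topologicalClosure := by rw [hdense]; trivial
  exact closure_minimal hSV hV h3

theorem productState_eq_prod_evalMap (σ : State D) {n : ℕ} (x : Fin n → D) :
    productState σ (InfMaxTensorPower.ofPow n (MaxTensorPower.elem x)) =
      (∏ i, evalMap (x i) : C(State D, ℂ)) σ := by
  rw [productState_elem, ContinuousMap.prod_apply]
  rfl

theorem continuous_productState (x : InfMaxTensorPower D) :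
    Continuous fun σ : State D => productState σ x := by
  let V : Submodule ℂ (InfMaxTensorPower D) :=
    { carrier := {x | Continuous fun σ : State D => productState σ x}
      add_mem' := fun {a b} ha hb => by
        simpa only [Set.mem_ofPred_eq, map_add] using! Continuous.add ha hb
      zero_mem' := by simpa only [Set.mem_ofPred_eq, map_zero] using! continuous_const
      smul_mem' := fun c a ha => by
        simpa only [Set.mem_ofPred_eq, map_smul] using! Continuous.const_smul ha c }
  refine mem_of_isClosed (V := V) ?_ (fun n x => ?_) x
  · refine isClosed_of_closure_subset fun a ha => ?_
    refine continuous_of_uniform_approx_of_continuous fun u hu => ?_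
    obtain ⟨ε, hε, hu⟩ := Metric.mem_uniformity_dist.mp hu
    obtain ⟨b, hb, hab⟩ := Metric.mem_closure_iff.mp ha ε hε
    refine ⟨_, hb, fun σ => hu ?_⟩
    rw [dist_eq_norm, ← map_sub]
    exact ((productState σ).norm_apply_le _).trans_lt (by rwa [← dist_eq_norm])
  · change Continuous _
    simp only [productState_eq_prod_evalMap]
    exact (∏ i, evalMap (x i) : C(State D, ℂ)).continuous

/-- The function `σ ↦ Π_σ x`, which is continuous and depends continuously on `x`. -/
def productMap : InfMaxTensorPower D →L[ℂ] C(State D, ℂ) :=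
  LinearMap.mkContinuous
    { toFun := fun x => ⟨fun σ => productState σ x, continuous_productState x⟩
      map_add' := fun x y => by ext σ; exact map_add (productState σ) x y
      map_smul' := fun c x => by ext σ; exact map_smul (productState σ) c x } 1 fun x => by
    rw [one_mul]
    exact (ContinuousMap.norm_le _ (norm_nonneg _)).mpr fun σ => (productState σ).norm_apply_le x

theorem productMap_elem {n : ℕ} (x : Fin n → D) :
    productMap (InfMaxTensorPower.ofPow n (MaxTensorPower.elem x)) = ∏ i, evalMap (x i) := by
  ext σ
  exact productState_eq_prod_evalMap σ x

/-- The integral formula extends by linearity and continuity from elementary tensors to `D^∞`. -/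
theorem eq_integral_productState (ρ : State (InfMaxTensorPower D)) (μ : Measure (State D))
    [IsFiniteMeasure μ] (h : ∀ (n : ℕ) (x : Fin n → D),
      ρ (InfMaxTensorPower.ofPow n (MaxTensorPower.elem x)) =
        ∫ σ, (∏ i, evalMap (x i) : C(State D, ℂ)) σ ∂μ) (x : InfMaxTensorPower D) :
    ρ x = ∫ σ, productState σ x ∂μ := by
  let V : Submodule ℂ (InfMaxTensorPower D) :=
    LinearMap.eqLocus ρ.toLinearMap ((integralMap μ).comp productMap).toLinearMap
  refine mem_of_isClosed (V := V) ?_ (fun n x => ?_) x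
  · exact isClosed_eq ρ.continuous_coe ((integralMap μ).comp productMap).continuous
  · change ρ _ = integralMap μ (productMap _)
    rw [productMap_elem, integralMap_apply, h]

end QuantumDeFinetti

theorem mainTheorem2 {D : Type*} [CStarAlgebra D]
    (ρ : QuantumDeFinetti.State (QuantumDeFinetti.InfMaxTensorPower D)) (hρ : ρ.IsSymmetric) :
    ∃! μ : MeasureTheory.Measure (QuantumDeFinetti.State D),
      MeasureTheory.IsProbabilityMeasure μ ∧ μ.Regular ∧
      ∀ x : QuantumDeFinetti.InfMaxTensorPower D,
        MeasureTheory.Integrable (fun σ => QuantumDeFinetti.productState σ x) μ ∧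
        ρ x = ∫ σ, QuantumDeFinetti.productState σ x ∂μ := by
  open QuantumDeFinetti MeasureTheory in
  obtain ⟨φ, hφ, hφρ⟩ := exists_functional hρ
  obtain ⟨μ, _, hreg, hμ⟩ := exists_measure_of_positive φ hφ
  have hrep : ∀ x, ρ x = ∫ σ, productState σ x ∂μ :=
    eq_integral_productState ρ μ fun n x => by rw [← hφρ, hμ]
  -- the total mass is `ρ 1 = ∫ 1 dμ`
  have hprob : IsProbabilityMeasure μ := by
    have h := hrep 1
    simp only [State.map_one, integral_const] at h
    have h1 : μ.real Set.univ = 1 := by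
      have h2 := congrArg Complex.re h
      simpa using h2.symm
    exact ⟨(ENNReal.toReal_eq_one_iff _).mp h1⟩
  refine ⟨μ, ⟨hprob, hreg, fun x => ⟨integrable_continuousMap μ (productMap x), hrep x⟩⟩, ?_⟩
  rintro ν ⟨_, _, hν⟩
  refine measure_ext_of_integral_eq ν μ fun f => ?_
  let V : Submodule ℂ C(State D, ℂ) :=
    LinearMap.eqLocus (integralMap ν).toLinearMap (integralMap μ).toLinearMap
  refine mem_of_prod_evalMap_mem (V := V)
    (isClosed_eq (integralMap ν).continuous (integralMap μ).continuous) (fun n x => ?_) f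
  change integralMap ν _ = integralMap μ _
  rw [← productMap_elem, integralMap_apply, integralMap_apply]
  exact (hν _).2.symm.trans (hrep _)

end
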